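/- Let $\alpha\in(0,1)$, $p>1$ real, $\beta\in(\max\{\alpha,\tfrac12\},1)$, $\varepsilon>0$ and an integer $k\ge 1$. Let $\mathbb T=\mathbb R/2\pi\mathbb Z$ and let $X^\beta$ be the space of even, zero-mean, $\beta$-Hölder continuous functions $\mathbb T\to\mathbb R$ with the Hölder norm. Let $|D|^{-\alpha}$ be the Fourier multiplier with symbol $|m|^{-\alpha}$, $m\in\mathbb Z\setminus\{0\}$, and consider the steady equation $$F^\varepsilon(\varphi,c):=|D|^{-\alpha}\varphi-c\varphi+n^\varepsilon(\varphi)-\frac1{2\pi}\int_{\mathbb T}n^\varepsilon(\varphi)\,dx=0,\qquad (\varphi,c)\in X^\beta\times[0,\infty),$$ where $$\text{(abs)}\quad n^\varepsilon(x)=(x^2+\varepsilon^2)^{p/2}-\varepsilon^p,\qquad\text{or}\qquad \text{(sgn)}\quad n^\varepsilon(x)=x\bigl((x^2+\varepsilon^2)^{(p-1)/2}-\varepsilon^{p-1}\bigr)$$ are the regularisations of $|x|^p$ and $x|x|^{p-1}$, respectively. **Theorem (Bifurcation formulas).** In each case there is a local analytic curve $s\mapsto(\varphi_k^\varepsilon(s),c_k^\varepsilon(s))\in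 X^\beta\times[0,\infty)$, $|s|<\delta$, of $2\pi/k$-periodic solutions of $F^\varepsilon(\varphi,c)=0$ that passes through $(0,k^{-\alpha})$ at $s=0$, has $\varphi_k^\varepsilon(s)\ne0$ for $s\neq 0$, and contains all solutions with $\varphi\neq0$ in a neighbourhood of $(0,k^{-\alpha})$ in $X^\beta\times[0,\infty)$. It can be parametrised by the $k$-th cosine coefficient, $\frac1\pi\int_{\mathbb T}\varphi_k^\varepsilon(s)(x)\cos(kx)\,dx=s$; with this parametrisation $s\mapsto c_k^\varepsilon(s)$ is even and, as $s\to0$ (the remainders of the profiles being in the norm of $X^\beta$), * in case (abs): $$\varphi_k^\varepsilon(s)(x)=s\cos kx+s^2C_{\mathrm{abs}}\cos 2kx+O(s^3),\qquad c_k^\varepsilon(s)=k^{-\alpha}+\tfrac12p\,\varepsilon^{p-2}C_{\mathrm{abs}}\,s^2+O(s^4);$$ * in case (sgn): $$\varphi_k^\varepsilon(s)(x)=s\cos kx+s^3C_{\mathrm{sgn}}\cos 3kx+O(s^5),\qquad c_k^\varepsilon(s)=k^{-\alpha}+\tfrac38(p-1)\varepsilon^{p-3}s^2+O(s^4),$$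 where $$C_{\mathrm{abs}}=\frac{\frac14p\,\varepsilon^{p-2}}{k^{-\alpha}-(2k)^{-\alpha}},\qquad C_{\mathrm{sgn}}=\frac{\frac18(p-1)\varepsilon^{p-3}}{k^{-\alpha}-(3k)^{-\alpha}}.$$ -/

import Mathlib

open Filter Topology Asymptotics MeasureTheory
open scoped NNReal Real

noncomputable section

namespace NegDispersive

instance factTwoPiPos : Fact (0 < 2 * π) := ⟨Real.two_pi_pos⟩

/-- The torus `ℝ / 2πℤ`, with its arc-length distance and Lebesgue measure (total mass `2π`). -/
abbrev Torus : Type := AddCircle (2 * π)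

/-- The even, `β`-Hölder continuous real functions with zero mean on the torus, as a subspace of
the continuous functions. -/
def evenHolderSubmodule (β : ℝ≥0) : Submodule ℝ C(Torus, ℝ) where
  carrier := {f | MemHolder β f ∧ (∀ x, f (-x) = f x) ∧ ∫ x, f x = 0}
  zero_mem' := ⟨memHolder_zero, fun _ => rfl, by simp⟩
  add_mem' := by
    rintro f g ⟨hf, hfe, hfi⟩ ⟨hg, hge, hgi⟩
    refine ⟨hf.add hg, fun x => by simp [hfe, hge], ?_⟩
    have h1 : Integrable f := f.continuous.integrable_of_hasCompactSupport
      (HasCompactSupport.of_compactSpace _)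
    have h2 : Integrable g := g.continuous.integrable_of_hasCompactSupport
      (HasCompactSupport.of_compactSpace _)
    simp [integral_add h1 h2, hfi, hgi]
  smul_mem' := by
    rintro a f ⟨hf, hfe, hfi⟩
    refine ⟨hf.smul (c := a), fun x => by simp [hfe], ?_⟩
    simp [integral_const_mul, hfi]

/-- The space `X^β` of even, zero-mean, `β`-Hölder functions on the torus. It is a separate type
so that it carries the Hölder norm below and not the supremum norm. -/
def EvenHolder (β : ℝ≥0) : Type := ↥(evenHolderSubmodule β)

namespace EvenHolder

variable {β : ℝ≥0}

instance : AddCommGroup (EvenHolder β) := inferInstanceAs (AddCommGroup ↥(evenHolderSubmodule β))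

instance : Module ℝ (EvenHolder β) := inferInstanceAs (Module ℝ ↥(evenHolderSubmodule β))

/-- The underlying continuous function. -/
def toCont (f : EvenHolder β) : C(Torus, ℝ) := f.1

instance : CoeFun (EvenHolder β) (fun _ => Torus → ℝ) := ⟨fun f => f.toCont⟩

theorem memHolder (f : EvenHolder β) : MemHolder β f := f.2.1

theorem toCont_injective : Function.Injective (toCont (β := β)) := Subtype.val_injective

/-- The Hölder norm: the supremum norm plus the best `β`-Hölder constant. -/
instance : Norm (EvenHolder β) := ⟨fun f => ‖f.toCont‖ + nnHolderNorm β f⟩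

theorem norm_def (f : EvenHolder β) : ‖f‖ = ‖f.toCont‖ + nnHolderNorm β f := rfl

theorem normCore : NormedSpace.Core ℝ (EvenHolder β) where
  norm_nonneg f := by rw [norm_def]; positivity
  norm_smul a f := by
    have h1 : (a • f).toCont = a • f.toCont := rfl
    have h2 : nnHolderNorm β (a • f) = ‖a‖₊ * nnHolderNorm β f :=
      f.memHolder.nnHolderNorm_smul (c := a)
    rw [norm_def, norm_def, h2, h1, norm_smul]
    push_cast
    ring
  norm_triangle f g := by
    have h1 : (f + g).toCont = f.toCont + g.toCont := rfl
    have h2 : nnHolderNorm β (f + g) ≤ nnHolderNorm β f + nnHolderNorm β g :=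
      f.memHolder.nnHolderNorm_add_le g.memHolder
    have h3 : (nnHolderNorm β (f + g) : ℝ) ≤ nnHolderNorm β f + nnHolderNorm β g := by
      exact_mod_cast h2
    have h4 := norm_add_le f.toCont g.toCont
    rw [norm_def, norm_def, norm_def]
    rw [← h1] at h4
    linarith
  norm_eq_zero_iff f := by
    constructor
    · intro h
      rw [norm_def] at h
      have h1 : ‖f.toCont‖ = 0 :=
        le_antisymm (by have := (nnHolderNorm β f).coe_nonneg; linarith) (norm_nonneg _)
      exact toCont_injective (norm_eq_zero.mp h1)
    · rintro rfl
      have h1 : (0 : EvenHolder β).toCont = 0 := rfl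
      rw [norm_def, h1]
      simp

instance : NormedAddCommGroup (EvenHolder β) := NormedAddCommGroup.ofCore normCore

instance : NormedSpace ℝ (EvenHolder β) := NormedSpace.ofCore normCore

end EvenHolder

/-- The function `x ↦ cos (m x)` on the torus. -/
def cosFun (m : ℕ+) : Torus → ℝ :=
  Function.Periodic.lift (f := fun x : ℝ => Real.cos (m * x)) (c := 2 * π) (fun x => by
    have h : (m : ℝ) * (x + 2 * π) = m * x + (m : ℕ) * (2 * π) := by ring
    simp only [h, Real.cos_add_nat_mul_two_pi])

theorem cosFun_coe (m : ℕ+) (x : ℝ) : cosFun m (x : Torus) = Real.cos (m * x) := rfl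

theorem cosFun_lipschitz (m : ℕ+) : LipschitzWith (m : ℝ≥0) (cosFun m) := by
  refine LipschitzWith.of_dist_le_mul fun x y => ?_
  induction x using QuotientAddGroup.induction_on with | H a => ?_
  induction y using QuotientAddGroup.induction_on with | H b => ?_
  set n : ℤ := round ((2 * π)⁻¹ * (a - b)) with hn
  have h1 : dist ((a : ℝ) : Torus) ((b : ℝ) : Torus) = |a - b - n * (2 * π)| := by
    rw [dist_eq_norm, ← AddCircle.coe_sub, AddCircle.norm_eq]
  have h2 : cosFun m (a : Torus) = Real.cos (m * (a - n * (2 * π))) := by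
    have h : (m : ℝ) * (a - n * (2 * π)) = m * a - ((m * n : ℤ) : ℝ) * (2 * π) := by
      push_cast; ring
    rw [cosFun_coe, h, Real.cos_sub_int_mul_two_pi]
  change dist (cosFun m (a : Torus)) (cosFun m (b : Torus)) ≤
    (m : ℝ≥0) * dist ((a : ℝ) : Torus) ((b : ℝ) : Torus)
  rw [h1, h2, cosFun_coe, Real.dist_eq]
  refine (Real.abs_cos_sub_cos_le _ _).trans (le_of_eq ?_)
  rw [← mul_sub, abs_mul, sub_right_comm, Nat.abs_cast]
  simp

theorem cosFun_neg (m : ℕ+) (x : Torus) : cosFun m (-x) = cosFun m x := by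
  induction x using QuotientAddGroup.induction_on with | H a => ?_
  change cosFun m ((-a : ℝ) : Torus) = cosFun m (a : Torus)
  rw [cosFun_coe, cosFun_coe, mul_neg, Real.cos_neg]

theorem integral_cosFun (m : ℕ+) : ∫ x, cosFun m x = 0 := by
  have hm : (m : ℝ) ≠ 0 := by exact_mod_cast m.ne_zero
  rw [← AddCircle.intervalIntegral_preimage (2 * π) 0]
  simp only [cosFun_coe]
  rw [intervalIntegral.integral_comp_mul_left (fun x => Real.cos x) hm, integral_cos]
  have h : (m : ℝ) * (0 + 2 * π) = 0 + (m : ℕ) * (2 * π) := by ring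
  rw [h, Real.sin_add_nat_mul_two_pi]
  simp

/-- The function `x ↦ cos (m x)`, `m ≥ 1`, as an element of `X^β`. -/
def cosMode {β : ℝ≥0} (hβ : β ≤ 1) (m : ℕ+) : EvenHolder β :=
  (⟨⟨cosFun m, (cosFun_lipschitz m).continuous⟩,
    MemHolder.of_le (holderWith_one.mpr (cosFun_lipschitz m)).memHolder hβ,
    cosFun_neg m, integral_cosFun m⟩ : ↥(evenHolderSubmodule β))

theorem cosMode_coe {β : ℝ≥0} (hβ : β ≤ 1) (m : ℕ+) (x : ℝ) :
    cosMode hβ m (x : Torus) = Real.cos (m * x) := rfl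

/-- The cosine coefficient `(1/π) ∫ f(x) cos (m x) dx` over the torus. -/
def cosineCoeff (f : Torus → ℝ) (m : ℕ+) : ℝ := π⁻¹ * ∫ x, f x * cosFun m x

/-- The Fourier multiplier `|D|^{-α}` on the torus: each Fourier coefficient of index `m ≠ 0` is
multiplied by `|m|^{-α}`. It acts on functions with zero mean; the sum leaves out `m = 0`. -/
def fracInt (α : ℝ) (f : Torus → ℝ) (x : Torus) : ℝ :=
  (∑' m : ℤ, if m = 0 then 0 else
    ((|(m : ℝ)| ^ (-α) : ℝ) : ℂ) * fourierCoeff (fun y => (f y : ℂ)) m * fourier m x).re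

/-- The regularisation of `|x|^p`. -/
def nAbs (p ε x : ℝ) : ℝ := (x ^ 2 + ε ^ 2) ^ (p / 2) - ε ^ p

/-- The regularisation of `x|x|^{p-1}`. -/
def nSgn (p ε x : ℝ) : ℝ := x * ((x ^ 2 + ε ^ 2) ^ ((p - 1) / 2) - ε ^ (p - 1))

/-- The steady operator `F(φ, c) = |D|^{-α} φ - (c φ - n(φ)) - ⨍ n(φ)`. -/
def steadyOp (α : ℝ) (n : ℝ → ℝ) {β : ℝ≥0} (φ : EvenHolder β) (c : ℝ) (x : Torus) : ℝ :=
  fracInt α φ x - (c * φ x - n (φ x)) - ⨍ y, n (φ y)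

/-- `(φ, c)` solves the steady equation with speed `c ≥ 0`. -/
def IsSteady (α : ℝ) (n : ℝ → ℝ) {β : ℝ≥0} (φ : EvenHolder β) (c : ℝ) : Prop :=
  0 ≤ c ∧ ∀ x, steadyOp α n φ c x = 0

/-- `s ↦ (φ s, c s)`, `|s| < δ`, parametrises the local curve of nontrivial `2π/k`-periodic
solutions bifurcating from the trivial line at `(0, k^{-α})`: it is analytic into `X^β × ℝ` and
exhausts the nontrivial solutions in `X^β × [0, ∞)` in a neighbourhood of `(0, k^{-α})`. -/
structure IsLocalCurve (α : ℝ) (n : ℝ → ℝ) {β : ℝ≥0} (k : ℕ+) (δ : ℝ)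
    (φ : ℝ → EvenHolder β) (c : ℝ → ℝ) : Prop where
  pos : 0 < δ
  analytic_profile : AnalyticOnNhd ℝ φ (Set.Ioo (-δ) δ)
  analytic_speed : AnalyticOnNhd ℝ c (Set.Ioo (-δ) δ)
  profile_zero : φ 0 = 0
  speed_zero : c 0 = (k : ℝ) ^ (-α)
  steady : ∀ s ∈ Set.Ioo (-δ) δ, IsSteady α n (φ s) (c s)
  nontrivial : ∀ s ∈ Set.Ioo (-δ) δ, s ≠ 0 → φ s ≠ 0
  periodic : ∀ s ∈ Set.Ioo (-δ) δ, ∀ x : Torus, φ s (x + ((2 * π / k : ℝ) : Torus)) = φ s x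
  exhausts : ∀ᶠ z : EvenHolder β × ℝ in 𝓝 (0, (k : ℝ) ^ (-α)),
    IsSteady α n z.1 z.2 → z.1 ≠ 0 → ∃ s ∈ Set.Ioo (-δ) δ, z = (φ s, c s)

/-- The constant `C_abs`. -/
def coeffAbs (α p ε : ℝ) (k : ℕ+) : ℝ :=
  (1 / 4 * p * ε ^ (p - 2)) / ((k : ℝ) ^ (-α) - (2 * k : ℝ) ^ (-α))

/-- The constant `C_sgn`. -/
def coeffSgn (α p ε : ℝ) (k : ℕ+) : ℝ :=
  (1 / 8 * (p - 1) * ε ^ (p - 3)) / ((k : ℝ) ^ (-α) - (3 * k : ℝ) ^ (-α))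

end NegDispersive

end

/-! Both nonlinearities have the form xʲ q(x²) with q analytic at 0: j = 2 and q(0) = (p/2) ε^(p-2)
for (abs), j = 3 and q(0) = ((p-1)/2) ε^(p-3) for (sgn). So the equation is L φ - c φ + N(φ) = 0,
where L is diagonal in the cosine basis and N is analytic and at least quadratic. At c = μ = k^(-α)
the linearisation has the kernel spanned by e = cos kx, because the symbol takes the value μ at only
one nonnegative frequency. `exists_bifurcation_curve` is the Crandall-Rabinowitz argument for this
situation: dividing by the amplitude s leaves an equation that the analytic implicit function
theorem solves, and an a priori bound on the part of φ off the kernel shows that every small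
nontrivial solution is found in this way.

The analysis takes place in ℓ¹ spaces of cosine coefficients instead of X^β. There multiplication is
bounded, and q acts as a power series in multiplication operators. Two such spaces are used. Series
in cos kmx with weight m + 1 represent Lipschitz functions of period 2π/k and embed into X^β; they
carry the curve, its analyticity and its period. Series in cos mx with weight 1 form the Wiener
algebra, which contains X^β by Bernstein's theorem since β > 1/2; they carry the exhaustion. By
uniqueness in the larger space the two curves agree (`exists_isLocalCurve`).

For the expansions, the component of the equation along e gives (c - μ) s = ℓ(N(φ)), and the
complementary component gives the profile (`bifurcation_curve_isBigO`). Translation by π/k reverses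
e, so c is even in s; in case (sgn) the symmetry φ ↦ -φ makes the profile odd. Parity raises each
remainder by one power (`isBigO_pow_succ_of_parity`). In case (abs), cos² = (1 + cos 2·)/2 has no
component along e, so the speed comes from the interaction of cos kx with the second harmonic. In
case (sgn), cos³ = (cos 3· + 3 cos)/4 yields the profile and the speed at once. -/

namespace NegDispersive

/-! ### Bifurcation from a simple eigenvalue in a Banach space. -/

section Abstract

variable {Y : Type*} [NormedAddCommGroup Y] [NormedSpace ℝ Y]

/-- The rescaled bifurcation equation: with `φ = s (e + y - ℓ(y) e)` and `c = μ + ℓ(y)`, it is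
`s⁻¹ (L φ - c φ + N φ) = 0`. -/
def rescaledEq (D : Y ≃L[ℝ] Y) (ℓ : Y →L[ℝ] ℝ) (e : Y) (R : ℝ × Y → Y) (z : ℝ × Y) : Y :=
  D z.2 - ℓ z.2 • (z.2 - ℓ z.2 • e) + z.1 • R (z.1, e + (z.2 - ℓ z.2 • e))

theorem rescaledEq_analyticAt (D : Y ≃L[ℝ] Y) (ℓ : Y →L[ℝ] ℝ) (e : Y) (R : ℝ × Y → Y)
    (hR : AnalyticAt ℝ R (0, e)) : AnalyticAt ℝ (rescaledEq D ℓ e R) (0, 0) := by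
  have hℓ : AnalyticAt ℝ (fun z : ℝ × Y => ℓ z.2) (0, 0) :=
    (ℓ.comp (ContinuousLinearMap.snd ℝ ℝ Y)).analyticAt _
  have hD : AnalyticAt ℝ (fun z : ℝ × Y => D z.2) (0, 0) :=
    ((D : Y →L[ℝ] Y).comp (ContinuousLinearMap.snd ℝ ℝ Y)).analyticAt _
  have hψ : AnalyticAt ℝ (fun z : ℝ × Y => z.2 - ℓ z.2 • e) (0, 0) :=
    analyticAt_snd.sub (hℓ.smul analyticAt_const)
  have hRc : AnalyticAt ℝ (fun z : ℝ × Y => R (z.1, e + (z.2 - ℓ z.2 • e))) (0, 0) := by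
    refine AnalyticAt.fun_comp (g := R) ?_ (analyticAt_fst.prod (analyticAt_const.add hψ))
    simpa using hR
  exact (hD.sub (hℓ.smul hψ)).add (analyticAt_fst.smul hRc)

/-- At s = 0 the term with R drops out and ℓ(y)(y - ℓ(y)e) is quadratic in y, so the partial
derivative in y is D. The single unknown y encodes both the speed, through ℓ(y), and the part of the
profile off the kernel. -/
theorem rescaledEq_hasFDerivAt (D : Y ≃L[ℝ] Y) (ℓ : Y →L[ℝ] ℝ) (e : Y) (R : ℝ × Y → Y)
    (hR : AnalyticAt ℝ R (0, e)) : ∃ f' : ℝ × Y →L[ℝ] Y,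
      HasFDerivAt (rescaledEq D ℓ e R) f' (0, 0) ∧
      f'.comp (ContinuousLinearMap.inr ℝ ℝ Y) = (D : Y →L[ℝ] Y) := by
  have h1 := (rescaledEq_analyticAt D ℓ e R hR).differentiableAt.hasFDerivAt
  refine ⟨_, h1, ?_⟩
  have h2 : HasFDerivAt (fun y : Y => rescaledEq D ℓ e R (0, y))
      ((fderiv ℝ (rescaledEq D ℓ e R) (0, 0)).comp (ContinuousLinearMap.inr ℝ ℝ Y)) 0 :=
    HasFDerivAt.comp (g := rescaledEq D ℓ e R) (f := fun y : Y => ((0 : ℝ), y)) 0 h1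
      (ContinuousLinearMap.inr ℝ ℝ Y).hasFDerivAt
  have h3 : HasFDerivAt (fun y : Y => rescaledEq D ℓ e R (0, y)) (D : Y →L[ℝ] Y) 0 := by
    have hψ : HasFDerivAt (fun y : Y => y - ℓ y • e)
        (ContinuousLinearMap.id ℝ Y - ℓ.smulRight e) 0 :=
      (ContinuousLinearMap.id ℝ Y - ℓ.smulRight e).hasFDerivAt
    have := ((D : Y →L[ℝ] Y).hasFDerivAt (x := (0 : Y))).sub ((ℓ.hasFDerivAt (x := (0 : Y))).smul hψ)
    convert this using 1
    · ext y; simp [rescaledEq]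
    · ext y; simp
  exact h2.unique h3

/-- The bifurcation equation solved for the component complementary to the kernel. -/
theorem reduced_equation (L : Y →L[ℝ] Y) (ℓ : Y →L[ℝ] ℝ) (e : Y) (μ : ℝ) (he : ℓ e = 1)
    (hLe : L e = μ • e) (D : Y ≃L[ℝ] Y) (hD : ∀ y, D y = L y - μ • y - ℓ y • e) (N : Y → Y)
    {u : Y} {c : ℝ} (hu : L u - c • u + N u = 0) :
    D (u - ℓ u • e + ((c - μ) * ℓ u) • e) = (c - μ) • (u - ℓ u • e) - N u := by
  have : N u = c • u - L u := by rw [← sub_eq_zero, ← hu]; abel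
  rw [hD, this]
  simp only [map_add, map_smul, he, hLe, map_sub, smul_eq_mul]
  module

/-- Inverting D in `reduced_equation` and projecting away e bounds the part off the kernel by |c -
μ| times itself plus O(‖u‖²). Near (0, μ) all but a term ‖u‖ |ℓ u| is absorbed on the left. The
factor |ℓ u| is the point: the part off the kernel stays small after division by ℓ u, and ℓ u = 0
forces u = 0. -/
theorem norm_le_of_reduced_equation (L : Y →L[ℝ] Y) (ℓ : Y →L[ℝ] ℝ) (e : Y) (μ : ℝ) (he : ℓ e = 1)
    (hLe : L e = μ • e) (D : Y ≃L[ℝ] Y)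
    (hD : ∀ y, D y = L y - μ • y - ℓ y • e) (N : Y → Y)
    (hN : N =O[𝓝 0] fun y => ‖y‖ ^ 2) :
    ∃ K > 0, ∀ᶠ z : Y × ℝ in 𝓝 (0, μ), L z.1 - z.2 • z.1 + N z.1 = 0 →
      ‖z.1 - ℓ z.1 • e‖ ≤ K * ‖z.1‖ * |ℓ z.1| := by
  obtain ⟨C, hC, hNC⟩ := hN.exists_pos
  rw [IsBigOWith] at hNC
  set A : Y →L[ℝ] Y := (ContinuousLinearMap.id ℝ Y - ℓ.smulRight e).comp (D.symm : Y →L[ℝ] Y) with hA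
  set a := ‖A‖ + 1 with ha
  have ha0 : 0 < a := by positivity
  refine ⟨2 * (a * C) * (‖e‖ + 1), by positivity, ?_⟩
  have e1 : ∀ᶠ z : Y × ℝ in 𝓝 (0, μ), ‖N z.1‖ ≤ C * ‖‖z.1‖ ^ 2‖ :=
    (continuous_fst.tendsto' (0, μ) 0 rfl).eventually hNC
  have e2 : ∀ᶠ z : Y × ℝ in 𝓝 (0, μ), a * |z.2 - μ| < 1 / 4 := by
    have : Tendsto (fun z : Y × ℝ => a * |z.2 - μ|) (𝓝 (0, μ)) (𝓝 0) :=
      Continuous.tendsto' (by fun_prop) _ _ (by simp)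
    exact this.eventually_lt_const (by norm_num)
  have e3 : ∀ᶠ z : Y × ℝ in 𝓝 (0, μ), a * C * ‖z.1‖ < 1 / 4 := by
    have : Tendsto (fun z : Y × ℝ => a * C * ‖z.1‖) (𝓝 (0, μ)) (𝓝 0) :=
      Continuous.tendsto' (by fun_prop) _ _ (by simp)
    exact this.eventually_lt_const (by norm_num)
  filter_upwards [e1, e2, e3] with z h1 h2 h3 hz
  obtain ⟨u, c⟩ := z
  simp only [norm_pow, norm_norm] at h1 h2 h3 hz ⊢
  set s := ℓ u with hs
  set χ := u - s • e with hχ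
  have hℓχ : ℓ χ = 0 := by simp [hχ, he, hs]
  have key : D (χ + ((c - μ) * s) • e) = (c - μ) • χ - N u :=
    reduced_equation L ℓ e μ he hLe D hD N hz
  have hχA : χ = A ((c - μ) • χ - N u) := by
    rw [← key, hA]
    simp [hℓχ, he]
  have hb : ‖χ‖ ≤ a * (|c - μ| * ‖χ‖ + C * ‖u‖ ^ 2) := by
    calc ‖χ‖ = ‖A ((c - μ) • χ - N u)‖ := by rw [← hχA]
      _ ≤ ‖A‖ * ‖(c - μ) • χ - N u‖ := A.le_opNorm _
      _ ≤ a * (|c - μ| * ‖χ‖ + C * ‖u‖ ^ 2) := by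
        gcongr
        · simp [ha]
        · refine (norm_sub_le _ _).trans ?_
          rw [norm_smul, Real.norm_eq_abs]
          gcongr
  have hu : ‖u‖ ≤ |s| * ‖e‖ + ‖χ‖ := by
    have : u = s • e + χ := by simp [hχ]
    calc ‖u‖ = ‖s • e + χ‖ := by rw [← this]
      _ ≤ _ := (norm_add_le _ _).trans (by rw [norm_smul, Real.norm_eq_abs])
  -- A quarter of ‖χ‖ is absorbed here and another in `n3`. This gives the factor 2 in the constant;
  -- the 1 added to ‖e‖ only makes its positivity immediate.
  have n1 : a * |c - μ| * ‖χ‖ ≤ 1 / 4 * ‖χ‖ := by gcongr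
  have n2 : a * C * ‖u‖ * ‖u‖ ≤ a * C * ‖u‖ * (|s| * ‖e‖ + ‖χ‖) := by gcongr
  have n3 : a * C * ‖u‖ * ‖χ‖ ≤ 1 / 4 * ‖χ‖ := by gcongr
  have n4 : 0 ≤ a * C * ‖u‖ * |s| := by positivity
  linarith

/-- Bifurcation from a simple eigenvalue, with a parametrisation by the component along the
kernel and exhaustion of the nontrivial solutions near the bifurcation point. -/
theorem exists_bifurcation_curve [CompleteSpace Y] (L : Y →L[ℝ] Y) (ℓ : Y →L[ℝ] ℝ) (e : Y) (μ : ℝ)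
    (he : ℓ e = 1) (hLe : L e = μ • e) (D : Y ≃L[ℝ] Y)
    (hD : ∀ y, D y = L y - μ • y - ℓ y • e) (N : Y → Y) (R : ℝ × Y → Y)
    (hR : AnalyticAt ℝ R (0, e)) (hNR : ∀ s y, N (s • y) = s ^ 2 • R (s, y))
    (hN : N =O[𝓝 0] fun y => ‖y‖ ^ 2) :
    ∃ (φ : ℝ → Y) (c : ℝ → ℝ), AnalyticAt ℝ φ 0 ∧ AnalyticAt ℝ c 0 ∧ φ 0 = 0 ∧ c 0 = μ ∧
      (∀ s, ℓ (φ s) = s) ∧ (∀ᶠ s in 𝓝 0, L (φ s) - c s • φ s + N (φ s) = 0) ∧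
      (fun s => φ s - s • e) =O[𝓝 0] (fun s : ℝ => s ^ 2) ∧
      ∀ᶠ z : Y × ℝ in 𝓝 (0, μ), L z.1 - z.2 • z.1 + N z.1 = 0 → z.1 ≠ 0 →
        z.1 = φ (ℓ z.1) ∧ z.2 = c (ℓ z.1) := by
  set G := rescaledEq D ℓ e R with hG
  have hGa : AnalyticAt ℝ G (0, 0) := rescaledEq_analyticAt D ℓ e R hR
  have hG0 : G (0, 0) = 0 := by simp [hG, rescaledEq]
  obtain ⟨f', hf', hf'D⟩ := rescaledEq_hasFDerivAt D ℓ e R hR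
  -- Here `⊤` is the analytic class, so the implicit function is analytic and not only smooth.
  have cdf : ContDiffAt ℝ ⊤ G (0, 0) := hGa.contDiffAt
  have pn : (⊤ : WithTop ℕ∞) ≠ 0 := by simp
  have hinv : (fderiv ℝ G (0, 0) ∘L .inr ℝ ℝ Y).IsInvertible := by
    rw [hf'.fderiv, hf'D]; exact ⟨D, rfl⟩
  set y : ℝ → Y := cdf.implicitFunction pn hinv with hy
  have hya : AnalyticAt ℝ y 0 := (cdf.contDiffAt_implicitFunction pn hinv).analyticAt
  have hy0 : y 0 = 0 := cdf.implicitFunction_apply_self pn hinv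
  have hyG : ∀ᶠ s in 𝓝 (0 : ℝ), G (s, y s) = 0 := by
    have := cdf.eventually_apply_implicitFunction pn hinv
    rwa [hG0] at this
  have hyU : ∀ᶠ v : ℝ × Y in 𝓝 (0, 0), G v = 0 → y v.1 = v.2 := by
    have := cdf.eventually_apply_eq_iff_implicitFunction pn hinv
    rw [hG0] at this
    exact this.mono fun v h => h.1
  have hscale : ∀ (s : ℝ) (η : Y), s • G (s, η) =
      L (s • (e + (η - ℓ η • e))) - (μ + ℓ η) • (s • (e + (η - ℓ η • e))) +
        N (s • (e + (η - ℓ η • e))) := by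
    intro s η
    rw [hNR, hG, rescaledEq, hD]
    simp only [map_add, map_smul, map_sub, hLe]
    module
  have hℓy : AnalyticAt ℝ (fun s => ℓ (y s)) 0 := (ℓ.analyticAt _).fun_comp hya
  have hψa : AnalyticAt ℝ (fun s => y s - ℓ (y s) • e) 0 := hya.sub (hℓy.smul analyticAt_const)
  refine ⟨fun s => s • (e + (y s - ℓ (y s) • e)), fun s => μ + ℓ (y s),
    analyticAt_id.smul (analyticAt_const.add hψa), analyticAt_const.add hℓy,
    by simp, by simp [hy0], fun s => by simp [he], ?_, ?_, ?_⟩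
  · filter_upwards [hyG] with s hs
    rw [← hscale, hs, smul_zero]
  · have h1 : (fun s => y s - ℓ (y s) • e) =O[𝓝 0] (fun s : ℝ => s) := by
      have := hψa.differentiableAt.isBigO_sub
      simpa [hy0] using this
    have h2 := (isBigO_refl (fun s : ℝ => s) (𝓝 0)).smul h1
    refine (h2.congr_left fun s => ?_).congr_right fun s => ?_
    · simp
    · simp [pow_two]
  · obtain ⟨K, hK, hred⟩ := norm_le_of_reduced_equation L ℓ e μ he hLe D hD N hN
    -- The rescaled profile ψ involves division by ℓ u and is not continuous at (0, μ); only a bound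
    -- on its norm is. Uniqueness is therefore stated for all ψ below a bound, and the bound tends
    -- to 0 with the solution.
    have hpair : ∀ᶠ p : ℝ × ℝ × ℝ in 𝓝 (0, 0, 0), ∀ ψ : Y, ‖ψ‖ ≤ p.2.2 →
        G (p.1, ψ + p.2.1 • e) = 0 → y p.1 = ψ + p.2.1 • e := by
      have h1 : Tendsto (fun q : (ℝ × ℝ) × Y => (q.1.1, q.2 + q.1.2 • e)) (𝓝 ((0, 0), 0))
          (𝓝 (0, 0)) := Continuous.tendsto' (by fun_prop) _ _ (by simp)
      have h2 := h1.eventually hyU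
      rw [nhds_prod_eq] at h2
      obtain ⟨pa, hpa, pb, hpb, hab⟩ := eventually_prod_iff.1 h2
      obtain ⟨r, hr, hrb⟩ := Metric.eventually_nhds_iff.1 hpb
      have h3 : Tendsto (fun p : ℝ × ℝ × ℝ => (p.1, p.2.1)) (𝓝 (0, 0, 0)) (𝓝 (0, 0)) :=
        Continuous.tendsto' (by fun_prop) _ _ (by simp)
      have h4 : Tendsto (fun p : ℝ × ℝ × ℝ => p.2.2) (𝓝 (0, 0, 0)) (𝓝 0) :=
        Continuous.tendsto' (by fun_prop) _ _ (by simp)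
      filter_upwards [h3.eventually hpa, h4.eventually_lt_const hr] with p h5 h6 ψ h7 h8
      exact hab h5 (hrb (by simpa using h7.trans_lt h6)) h8
    have hT : Tendsto (fun z : Y × ℝ => (ℓ z.1, z.2 - μ, K * ‖z.1‖)) (𝓝 (0, μ)) (𝓝 (0, 0, 0)) :=
      Continuous.tendsto' (by fun_prop) _ _ (by simp)
    filter_upwards [hred, hT.eventually hpair] with z h1 h2 hz hz0
    obtain ⟨u, c⟩ := z
    simp only at h1 h2 hz hz0 ⊢
    have hχ := h1 hz
    set s := ℓ u with hs
    have hs0 : s ≠ 0 := by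
      intro h0
      rw [h0] at hχ
      simp at hχ
      exact hz0 hχ
    set ψ := s⁻¹ • (u - s • e) with hψ
    have hℓψ : ℓ ψ = 0 := by simp [hψ, he, hs]
    have hu : u = s • (e + ψ) := by simp [hψ, smul_smul, hs0]
    have hψn : ‖ψ‖ ≤ K * ‖u‖ := by
      rw [hψ, norm_smul, norm_inv, Real.norm_eq_abs, inv_mul_le_iff₀ (abs_pos.2 hs0)]
      linarith
    -- This inverts the substitution of `rescaledEq`: the component along e is the increment of the
    -- speed.
    set η := ψ + (c - μ) • e with hη
    have hℓη : ℓ η = c - μ := by simp [hη, hℓψ, he]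
    have hηψ : η - ℓ η • e = ψ := by rw [hℓη]; simp [hη]
    have hGη : G (s, η) = 0 := by
      have h3 := hscale s η
      rw [hηψ, hℓη, ← hu, add_sub_cancel, hz] at h3
      exact (smul_eq_zero.1 h3).resolve_left hs0
    have hyη : y s = η := h2 ψ hψn hGη
    refine ⟨?_, ?_⟩
    · rw [hyη, hηψ]; exact hu
    · rw [hyη, hℓη]; ring

/-- A symmetry of the equation that reverses the kernel reverses the bifurcation curve. -/
theorem bifurcation_curve_symm (L : Y →L[ℝ] Y) (ℓ : Y →L[ℝ] ℝ) (μ : ℝ) (N : Y → Y)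
    (φ : ℝ → Y) (c : ℝ → ℝ) (hφ : ContinuousAt φ 0) (hc : ContinuousAt c 0)
    (hφ0 : φ 0 = 0) (hc0 : c 0 = μ) (hℓφ : ∀ s, ℓ (φ s) = s)
    (hsol : ∀ᶠ s in 𝓝 0, L (φ s) - c s • φ s + N (φ s) = 0)
    (hex : ∀ᶠ z : Y × ℝ in 𝓝 (0, μ), L z.1 - z.2 • z.1 + N z.1 = 0 → z.1 ≠ 0 →
        z.1 = φ (ℓ z.1) ∧ z.2 = c (ℓ z.1))
    (S : Y →L[ℝ] Y) (hℓS : ∀ y, ℓ (S y) = - ℓ y) (hLS : ∀ y, L (S y) = S (L y))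
    (hNS : ∀ᶠ y in 𝓝 0, N (S y) = S (N y)) :
    ∀ᶠ s in 𝓝 0, φ (-s) = S (φ s) ∧ c (-s) = c s := by
  have h1 : Tendsto (fun s => (S (φ s), c s)) (𝓝 0) (𝓝 (0, μ)) := by
    have : ContinuousAt (fun s => (S (φ s), c s)) 0 :=
      (S.continuous.continuousAt.comp hφ).prodMk hc
    simpa [ContinuousAt, hφ0, hc0] using this
  have h2 : Tendsto φ (𝓝 0) (𝓝 0) := by simpa [ContinuousAt, hφ0] using hφ
  filter_upwards [h1.eventually hex, hsol, h2.eventually hNS] with s h3 h4 h5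
  rcases eq_or_ne s 0 with rfl | hs
  · simp [hφ0]
  · have h6 : S (φ s) ≠ 0 := by
      intro h
      have := hℓS (φ s)
      rw [h, hℓφ] at this
      simp at this
      exact hs this
    -- The reflected point is again a small nontrivial solution, and its component along the kernel
    -- is -s; exhaustion places it on the curve at -s.
    have h7 := h3 (by
      simp only [hLS, h5]
      rw [← map_smul, ← map_sub, ← map_add, h4, map_zero]) h6
    simp only [hℓS, hℓφ] at h7
    exact ⟨h7.1.symm, h7.2.symm⟩

/-- An analytic `f = O(sⁿ)` with the parity opposite to that of `sⁿ` is `O(sⁿ⁺¹)`. -/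
theorem isBigO_pow_succ_of_parity {f : ℝ → Y} (n : ℕ) (hf : AnalyticAt ℝ f 0)
    (ho : f =O[𝓝 0] fun s : ℝ => s ^ n)
    (hpar : ∀ᶠ s in 𝓝 0, f (-s) = (-1 : ℝ) ^ (n + 1) • f s) :
    f =O[𝓝 0] fun s : ℝ => s ^ (n + 1) := by
  rcases eq_or_ne (analyticOrderAt f 0) ⊤ with htop | htop
  · rw [analyticOrderAt_eq_top] at htop
    exact (isBigO_zero _ _).congr' (htop.mono fun s hs => hs.symm) EventuallyEq.rfl
  · obtain ⟨g, hg, hg0, hfg⟩ := hf.analyticOrderAt_ne_top.1 htop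
    set m := analyticOrderNatAt f 0
    simp only [sub_zero] at hfg
    have hgc : Tendsto g (𝓝[≠] 0) (𝓝 (g 0)) := hg.continuousAt.tendsto.mono_left nhdsWithin_le_nhds
    -- An order m below n contradicts the bound, since g would tend to 0. The order m = n
    -- contradicts the parity, since it gives g(0) = -g(0).
    have hmn : n < m := by
      by_contra! hle
      rcases hle.lt_or_eq with hlt | heq
      · have h1 : g =O[𝓝[≠] 0] fun s : ℝ => s ^ (n - m) := by
          have h2 : (fun s : ℝ => s ^ m • g s) =O[𝓝[≠] 0] fun s : ℝ => s ^ n :=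
            (ho.congr' hfg EventuallyEq.rfl).mono nhdsWithin_le_nhds
          have h3 := (isBigO_refl (fun s : ℝ => (s ^ m)⁻¹) (𝓝[≠] 0)).smul h2
          refine h3.congr' ?_ ?_ <;> filter_upwards [self_mem_nhdsWithin] with s hs
          · rw [smul_smul, inv_mul_cancel₀ (pow_ne_zero _ hs), one_smul]
          · rw [smul_eq_mul, inv_mul_eq_div, pow_sub₀ _ hs hle, div_eq_mul_inv]
        have h4 : Tendsto (fun s : ℝ => s ^ (n - m)) (𝓝[≠] 0) (𝓝 0) :=
          ((continuous_pow (n - m)).tendsto' 0 0 (zero_pow (by omega))).mono_left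
            nhdsWithin_le_nhds
        exact hg0 (tendsto_nhds_unique hgc (h1.trans_tendsto h4))
      · have hneg : Tendsto (fun s : ℝ => -s) (𝓝 0) (𝓝 0) :=
          continuous_neg.tendsto' 0 0 neg_zero
        have h1 : Tendsto (fun s => g (-s)) (𝓝[≠] 0) (𝓝 (g 0)) :=
          (hg.continuousAt.tendsto.comp hneg).mono_left nhdsWithin_le_nhds
        have h2 : (fun s => g (-s)) =ᶠ[𝓝[≠] 0] fun s => - g s := by
          filter_upwards [nhdsWithin_le_nhds hpar, nhdsWithin_le_nhds hfg,
            nhdsWithin_le_nhds (hneg.eventually hfg), self_mem_nhdsWithin] with s h3 h4 h5 hs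
          rw [h4, h5, heq, neg_pow, pow_succ, mul_smul, mul_smul] at h3
          have h6 : s ^ n • (g (-s)) = s ^ n • (- g s) := by
            rw [smul_neg]
            have h7 : ((-1 : ℝ) ^ n) ≠ 0 := pow_ne_zero _ (by norm_num)
            apply smul_right_injective Y h7
            simpa using h3
          exact smul_right_injective Y (pow_ne_zero n hs) h6
        have h3 : g 0 = - g 0 := tendsto_nhds_unique h1 (hgc.neg.congr' h2.symm)
        have h4 : (2 : ℝ) • g 0 = 0 := by
          rw [two_smul]; nth_rewrite 1 [h3]; exact neg_add_cancel _
        exact hg0 ((smul_eq_zero.1 h4).resolve_left two_ne_zero)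
    have h1 : (fun s : ℝ => s ^ m • g s) =O[𝓝 0] fun s : ℝ => s ^ (n + 1) := by
      have h2 : (fun s : ℝ => s ^ m) =O[𝓝 0] fun s : ℝ => s ^ (n + 1) := by
        have h3 : (fun s : ℝ => s ^ (m - (n + 1))) =O[𝓝 0] fun _ => (1 : ℝ) :=
          (continuous_pow _).continuousAt.isBigO_one ℝ
        have h4 := (isBigO_refl (fun s : ℝ => s ^ (n + 1)) (𝓝 0)).mul h3
        refine (h4.congr_left fun s => ?_).congr_right fun s => ?_
        · rw [← pow_add]; congr 1; omega
        · simp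
      have h5 := h2.smul (hg.continuousAt.isBigO_one ℝ)
      exact h5.congr_right fun s => by simp
    exact h1.congr' (hfg.mono fun s hs => hs.symm) EventuallyEq.rfl

/-- If `s f(s) = O(sⁿ⁺¹)` and `f 0 = 0`, then `f = O(sⁿ)`. -/
theorem isBigO_of_smul_id {f : ℝ → Y} {n : ℕ} (hf0 : f 0 = 0)
    (h : (fun s : ℝ => s • f s) =O[𝓝 0] fun s : ℝ => s ^ (n + 1)) :
    f =O[𝓝 0] fun s : ℝ => s ^ n := by
  obtain ⟨C, hC, hb⟩ := h.exists_pos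
  refine IsBigO.of_bound C ?_
  filter_upwards [hb.bound] with s hs
  rcases eq_or_ne s 0 with rfl | h0
  · rw [hf0, norm_zero]; positivity
  · rw [norm_smul, pow_succ', norm_mul] at hs
    have := norm_pos_iff.2 h0
    exact le_of_mul_le_mul_left (by linarith) this

/-- Leading order of the bifurcation curve when the nonlinearity along it is `sⁿ v + O(sⁿ⁺¹)`. -/
theorem bifurcation_curve_isBigO (L : Y →L[ℝ] Y) (ℓ : Y →L[ℝ] ℝ) (e : Y) (μ : ℝ) (he : ℓ e = 1)
    (hLe : L e = μ • e) (D : Y ≃L[ℝ] Y) (hD : ∀ y, D y = L y - μ • y - ℓ y • e) (N : Y → Y)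
    (φ : ℝ → Y) (c : ℝ → ℝ) (hℓφ : ∀ s, ℓ (φ s) = s)
    (hsol : ∀ᶠ s in 𝓝 0, L (φ s) - c s • φ s + N (φ s) = 0) (n : ℕ) (u v : Y)
    (hu : ℓ u = 0) (huv : D u = v - ℓ v • e)
    (hN : (fun s => N (φ s) - s ^ n • v) =O[𝓝 0] fun s : ℝ => s ^ (n + 1))
    (hc : (fun s => (c s - μ) • (φ s - s • e)) =O[𝓝 0] fun s : ℝ => s ^ (n + 1)) :
    (fun s => φ s - s • e + s ^ n • u) =O[𝓝 0] fun s : ℝ => s ^ (n + 1) := by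
  set A : Y →L[ℝ] Y := (ContinuousLinearMap.id ℝ Y - ℓ.smulRight e).comp (D.symm : Y →L[ℝ] Y)
    with hA
  -- The component of v along e affects only the speed: D⁻¹ sends e to -e, which the projection in A
  -- removes.
  have hDe : D e = -e := by rw [hD, hLe, he]; simp
  have hAv : A v = u := by
    have h1 : D (u - ℓ v • e) = v := by rw [map_sub, huv, map_smul, hDe]; simp
    have h2 : D.symm v = u - ℓ v • e := by rw [← h1, D.symm_apply_apply, h1]
    simp [hA, h2, hu, he]
  have h1 := (A.isBigO_comp (fun s => (c s - μ) • (φ s - s • e) - (N (φ s) - s ^ n • v))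
    (𝓝 0)).trans (hc.sub hN)
  refine h1.congr' ?_ EventuallyEq.rfl
  filter_upwards [hsol] with s hs
  have key := reduced_equation L ℓ e μ he hLe D hD N hs
  rw [hℓφ] at key
  have h2 : (c s - μ) • (φ s - s • e) - (N (φ s) - s ^ n • v) =
      D (φ s - s • e + ((c s - μ) * s) • e) + s ^ n • v := by rw [key]; abel
  rw [h2, map_add, map_smul, hAv]
  congr 1
  simp [hA, he, hℓφ]

/-- The speed along the bifurcation curve in terms of the nonlinearity. -/
theorem bifurcation_curve_speed (L : Y →L[ℝ] Y) (ℓ : Y →L[ℝ] ℝ) (μ : ℝ)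
    (hℓL : ∀ y, ℓ (L y) = μ * ℓ y) (N : Y → Y) {u : Y} {c : ℝ} (hu : L u - c • u + N u = 0) :
    (c - μ) * ℓ u = ℓ (N u) := by
  have := congrArg ℓ hu
  simp only [map_add, map_sub, map_smul, hℓL, map_zero, smul_eq_mul] at this
  linarith

end Abstract

end NegDispersive

/-! ### The space ℓ¹ and bounded operators determined on its basis. -/

namespace NegDispersive

/-- Absolutely summable real sequences. -/
abbrev EllOne : Type := lp (fun _ : ℕ => ℝ) 1

namespace EllOne

/-- The standard basis sequences. -/
noncomputable def delta (m : ℕ) : EllOne := lp.single 1 m (1 : ℝ)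

theorem delta_apply (m n : ℕ) : delta m n = if n = m then 1 else 0 := by
  rw [delta, lp.single_apply]
  split_ifs with h
  · subst h; simp
  · simp [h]

theorem hasSum_norm (a : EllOne) : HasSum (fun m => |a m|) ‖a‖ := by
  have := lp.hasSum_norm (p := 1) (by simp) a
  simpa using this

theorem norm_delta (m : ℕ) : ‖delta m‖ = 1 := by
  rw [delta, lp.norm_single (by simp)]; simp

theorem hasSum_delta (a : EllOne) : HasSum (fun m => a m • delta m) a := by
  have := lp.hasSum_single (p := 1) (by simp) a
  refine this.congr_fun fun m => ?_
  rw [delta, ← lp.single_smul]; simp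

/-- The coordinate functionals. -/
noncomputable def coord (m : ℕ) : EllOne →L[ℝ] ℝ := lp.evalCLM ℝ (fun _ : ℕ => ℝ) 1 m

@[simp]
theorem coord_apply (m : ℕ) (a : EllOne) : coord m a = a m := rfl

variable {E : Type*} [NormedAddCommGroup E] [NormedSpace ℝ E]

/-- Identities between bounded operators reduce to the basis, where they become trigonometry or
arithmetic. -/
theorem clm_ext {f g : EllOne →L[ℝ] E} (h : ∀ m, f (delta m) = g (delta m)) : f = g := by
  ext a
  have h1 := (hasSum_delta a).mapL f
  have h2 := (hasSum_delta a).mapL g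
  simp only [map_smul, h] at h1 h2
  exact h1.unique h2

theorem summable_norm_smul (a : EllOne) {v : ℕ → E} {C : ℝ} (hv : ∀ m, ‖v m‖ ≤ C) :
    Summable fun m => ‖a m • v m‖ := by
  refine Summable.of_nonneg_of_le (fun _ => norm_nonneg _) (fun m => ?_)
    ((hasSum_norm a).summable.mul_right C)
  rw [norm_smul, Real.norm_eq_abs]
  gcongr
  exact hv m

theorem norm_tsum_smul_le (a : EllOne) {v : ℕ → E} {C : ℝ} (hv : ∀ m, ‖v m‖ ≤ C) :
    ‖∑' m, a m • v m‖ ≤ C * ‖a‖ := by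
  have h1 : HasSum (fun m => C * |a m|) (C * ‖a‖) := (hasSum_norm a).mul_left C
  have h2 : ∀ m, ‖a m • v m‖ ≤ C * |a m| := fun m => by
    rw [norm_smul, Real.norm_eq_abs, mul_comm C]
    exact mul_le_mul_of_nonneg_left (hv m) (abs_nonneg _)
  exact tsum_of_norm_bounded h1 h2

variable [CompleteSpace E]

theorem summable_smul (a : EllOne) {v : ℕ → E} {C : ℝ} (hv : ∀ m, ‖v m‖ ≤ C) :
    Summable fun m => a m • v m := (summable_norm_smul a hv).of_norm

/-- The linear map underlying `EllOne.lift`. -/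
noncomputable def liftLinear (v : ℕ → E) (C : ℝ) (hv : ∀ m, ‖v m‖ ≤ C) : EllOne →ₗ[ℝ] E where
  toFun a := ∑' m, a m • v m
  map_add' a b := by
    rw [← (summable_smul a hv).tsum_add (summable_smul b hv)]
    exact tsum_congr fun m => by rw [lp.coeFn_add, Pi.add_apply, add_smul]
  map_smul' r a := by
    rw [RingHom.id_apply, ← (summable_smul a hv).tsum_const_smul]
    exact tsum_congr fun m => by rw [lp.coeFn_smul, Pi.smul_apply, smul_assoc]

/-- The bounded linear map on `EllOne` taking prescribed bounded values on the basis. -/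
noncomputable def lift (v : ℕ → E) (C : ℝ) (hv : ∀ m, ‖v m‖ ≤ C) : EllOne →L[ℝ] E :=
  (liftLinear v C hv).mkContinuous C fun a => norm_tsum_smul_le a hv

theorem lift_apply (v : ℕ → E) (C : ℝ) (hv : ∀ m, ‖v m‖ ≤ C) (a : EllOne) :
    lift v C hv a = ∑' m, a m • v m := rfl

theorem hasSum_lift (v : ℕ → E) (C : ℝ) (hv : ∀ m, ‖v m‖ ≤ C) (a : EllOne) :
    HasSum (fun m => a m • v m) (lift v C hv a) := (summable_smul a hv).hasSum

@[simp]
theorem lift_delta (v : ℕ → E) (C : ℝ) (hv : ∀ m, ‖v m‖ ≤ C) (m : ℕ) :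
    lift v C hv (delta m) = v m := by
  rw [lift_apply, tsum_eq_single m fun n hn => by rw [delta_apply, if_neg hn, zero_smul],
    delta_apply, if_pos rfl, one_smul]

theorem norm_lift_apply_le (v : ℕ → E) (C : ℝ) (hv : ∀ m, ‖v m‖ ≤ C) (a : EllOne) :
    ‖lift v C hv a‖ ≤ C * ‖a‖ := norm_tsum_smul_le a hv

theorem norm_lift_le (v : ℕ → E) (C : ℝ) (hv : ∀ m, ‖v m‖ ≤ C) : ‖lift v C hv‖ ≤ C :=
  ContinuousLinearMap.opNorm_le_bound _ ((norm_nonneg _).trans (hv 0)) (norm_lift_apply_le v C hv)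

/-- The multiplication of the coefficients by a bounded sequence. -/
noncomputable def diag (d : ℕ → ℝ) (C : ℝ) (hd : ∀ m, |d m| ≤ C) : EllOne →L[ℝ] EllOne :=
  lift (fun m => d m • delta m) C fun m => by
    rw [norm_smul, norm_delta, mul_one]; exact hd m

@[simp]
theorem diag_delta (d : ℕ → ℝ) (C : ℝ) (hd : ∀ m, |d m| ≤ C) (m : ℕ) :
    diag d C hd (delta m) = d m • delta m := lift_delta ..

@[simp]
theorem diag_apply (d : ℕ → ℝ) (C : ℝ) (hd : ∀ m, |d m| ≤ C) (a : EllOne) (n : ℕ) :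
    diag d C hd a n = d n * a n := by
  have : (coord n).comp (diag d C hd) = d n • coord n := by
    refine clm_ext fun m => ?_
    simp only [ContinuousLinearMap.comp_apply, diag_delta, map_smul, coord_apply,
      smul_apply, delta_apply, smul_eq_mul]
    split_ifs with h
    · rw [h]
    · simp
  exact DFunLike.congr_fun this a

/-- A diagonal operator whose symbol is bounded above and below, as an isomorphism. -/
noncomputable def diagEquiv (d : ℕ → ℝ) (C C' : ℝ) (hd : ∀ m, |d m| ≤ C)
    (hd' : ∀ m, |(d m)⁻¹| ≤ C') (h0 : ∀ m, d m ≠ 0) : EllOne ≃L[ℝ] EllOne :=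
  ContinuousLinearEquiv.equivOfInverse (diag d C hd) (diag (fun m => (d m)⁻¹) C' hd')
    (fun a => by ext n; simp [h0])
    (fun a => by ext n; simp [h0])

end EllOne

end NegDispersive

/-! ### Weighted cosine series: multiplication, evaluation and functional calculus. -/

namespace NegDispersive

/-- The function `x ↦ cos (m x)` on the torus, `m ≥ 0`. -/
noncomputable def cosT (m : ℕ) : C(Torus, ℝ) :=
  ⟨fun x => (fourier (T := 2 * π) (m : ℤ) x).re,
    Complex.continuous_re.comp (fourier (m : ℤ)).continuous⟩

theorem cosT_apply (m : ℕ) (x : Torus) : cosT m x = (fourier (T := 2 * π) (m : ℤ) x).re := rfl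

theorem cosT_coe (m : ℕ) (x : ℝ) : cosT m (x : Torus) = Real.cos (m * x) := by
  rw [cosT_apply, fourier_coe_apply, ← Complex.exp_ofReal_mul_I_re]
  congr 2
  push_cast
  have : (π : ℂ) ≠ 0 := by exact_mod_cast Real.pi_ne_zero
  field_simp

theorem cosT_eq_cosFun (m : ℕ+) (x : Torus) : cosT m x = cosFun m x := by
  induction x using QuotientAddGroup.induction_on with | H a => ?_
  exact (cosT_coe m a).trans (cosFun_coe m a).symm

theorem cosT_zero (x : Torus) : cosT 0 x = 1 := by simp [cosT_apply]

theorem cosT_neg (m : ℕ) (x : Torus) : cosT m (-x) = cosT m x := by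
  induction x using QuotientAddGroup.induction_on with | H a => ?_
  change cosT m ((-a : ℝ) : Torus) = cosT m (a : Torus)
  rw [cosT_coe, cosT_coe, mul_neg, Real.cos_neg]

theorem abs_cosT_le (m : ℕ) (x : Torus) : |cosT m x| ≤ 1 := by
  induction x using QuotientAddGroup.induction_on with | H a => ?_
  exact (cosT_coe m a) ▸ Real.abs_cos_le_one _

theorem cosT_mul (m n : ℕ) (x : Torus) :
    cosT m x * cosT n x = (cosT (m + n) x + cosT (Nat.dist m n) x) / 2 := by
  induction x using QuotientAddGroup.induction_on with | H a => ?_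
  simp only [cosT_coe]
  have h : Real.cos ((Nat.dist m n : ℕ) * a) = Real.cos (m * a - n * a) := by
    rcases le_total m n with h | h
    · rw [Nat.dist_eq_sub_of_le h, Nat.cast_sub h, sub_mul, ← Real.cos_neg, neg_sub]
    · rw [Nat.dist_eq_sub_of_le_right h, Nat.cast_sub h, sub_mul]
  rw [h, Nat.cast_add, add_mul, Real.cos_add, Real.cos_sub]
  ring

/-- Weights for which the weighted cosine coefficients form a Banach algebra. -/
structure IsWeight (w : ℕ → ℝ) : Prop where
  zero : w 0 = 1
  one_le : ∀ m, 1 ≤ w m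
  add_le : ∀ m n, w (m + n) ≤ w m * w n
  dist_le : ∀ m n, w (Nat.dist m n) ≤ w m * w n

/-- This weight gives the even part of the Wiener algebra, which receives the coefficients of Hölder
functions. -/
theorem isWeight_one : IsWeight fun _ => 1 := by constructor <;> simp

/-- This weight makes the termwise derivative of the cosine series absolutely convergent, hence the
sums Lipschitz. -/
theorem isWeight_succ : IsWeight fun m => (m : ℝ) + 1 where
  zero := by simp
  one_le m := by simp
  add_le m n := by
    push_cast
    nlinarith [mul_nonneg (Nat.cast_nonneg (α := ℝ) m) (Nat.cast_nonneg (α := ℝ) n)]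
  dist_le m n := by
    have h : ((Nat.dist m n : ℕ) : ℝ) ≤ m + n := by
      have : Nat.dist m n ≤ m + n := by unfold Nat.dist; omega
      exact_mod_cast this
    nlinarith [mul_nonneg (Nat.cast_nonneg (α := ℝ) m) (Nat.cast_nonneg (α := ℝ) n)]

namespace IsWeight

open EllOne

variable {w : ℕ → ℝ} (hw : IsWeight w)
include hw

theorem pos (m : ℕ) : 0 < w m := zero_lt_one.trans_le (hw.one_le m)

theorem ne_zero (m : ℕ) : w m ≠ 0 := (hw.pos m).ne'

end IsWeight

open EllOne

/-- The sequence that represents `cos (κ m x)`. -/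
noncomputable def mode (w : ℕ → ℝ) (m : ℕ) : EllOne := w m • delta m

/-- The product of two basis elements. -/
noncomputable def deltaMul (w : ℕ → ℝ) (m n : ℕ) : EllOne :=
  (2 * w m * w n)⁻¹ • (mode w (m + n) + mode w (Nat.dist m n))

/-- A product of cosines contains the frequencies m + n and |m - n|; the weight is submultiplicative
along both. -/
theorem norm_deltaMul_le {w : ℕ → ℝ} (hw : IsWeight w) (m n : ℕ) : ‖deltaMul w m n‖ ≤ 1 := by
  have h1 := hw.pos m
  have h2 := hw.pos n
  rw [deltaMul, norm_smul, Real.norm_of_nonneg (by positivity), inv_mul_le_iff₀ (by positivity),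
    mul_one]
  refine (norm_add_le _ _).trans ?_
  rw [mode, mode, norm_smul, norm_smul, norm_delta, norm_delta,
    Real.norm_of_nonneg (hw.pos _).le, Real.norm_of_nonneg (hw.pos _).le]
  linarith [hw.add_le m n, hw.dist_le m n]

/-- The multiplication operators: `mulOp hw a` is the multiplication by the function that `a`
represents. -/
noncomputable def mulOp {w : ℕ → ℝ} (hw : IsWeight w) : EllOne →L[ℝ] EllOne →L[ℝ] EllOne :=
  lift (fun m => lift (deltaMul w m) 1 (norm_deltaMul_le hw m)) 1
    fun m => norm_lift_le _ 1 (norm_deltaMul_le hw m)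

theorem norm_cosT_div_le {w : ℕ → ℝ} (hw : IsWeight w) (m n : ℕ) (x : Torus) :
    ‖(w m)⁻¹ * cosT n x‖ ≤ 1 := by
  rw [norm_mul, Real.norm_eq_abs, Real.norm_eq_abs]
  refine mul_le_one₀ ?_ (abs_nonneg _) (abs_cosT_le _ _)
  rw [abs_of_pos (inv_pos.2 (hw.pos m))]
  exact inv_le_one_of_one_le₀ (hw.one_le m)

/-- The evaluation at `x` of the function `∑ aₘ cos (κ m x) / w m`. -/
noncomputable def ev (κ : ℕ) {w : ℕ → ℝ} (hw : IsWeight w) (x : Torus) : EllOne →L[ℝ] ℝ :=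
  lift (fun m => (w m)⁻¹ * cosT (κ * m) x) 1 fun m => norm_cosT_div_le hw m (κ * m) x

section

variable {w : ℕ → ℝ} (hw : IsWeight w)

theorem mulOp_delta (m n : ℕ) : mulOp hw (delta m) (delta n) = deltaMul w m n := by
  rw [mulOp, lift_delta, lift_delta]

theorem mulOp_mode (m n : ℕ) : mulOp hw (mode w m) (mode w n) =
    (1 / 2 : ℝ) • (mode w (m + n) + mode w (Nat.dist m n)) := by
  have h1 := hw.ne_zero m
  have h2 := hw.ne_zero n
  rw [mode, mode, map_smul, map_smul, smul_apply, mulOp_delta, deltaMul, smul_smul, smul_smul]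
  congr 1
  field_simp

theorem norm_mulOp_le (a : EllOne) : ‖mulOp hw a‖ ≤ ‖a‖ := by
  have := norm_lift_apply_le _ 1 (fun m => norm_lift_le _ 1 (norm_deltaMul_le hw m)) a
  rwa [one_mul] at this

/-- The sequence `delta 0` represents the constant 1. Applying a multiplication operator to it
recovers the function, and so leads from the operator calculus back to sequences. -/
theorem mulOp_zero_mode (a : EllOne) : mulOp hw a (delta 0) = a := by
  have : (mulOp hw).flip (delta 0) = ContinuousLinearMap.id ℝ EllOne := by
    refine clm_ext fun m => ?_
    have h1 := hw.ne_zero m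
    rw [ContinuousLinearMap.flip_apply, mulOp_delta, deltaMul]
    simp only [add_zero, Nat.dist_zero_right, mode, hw.zero, mul_one, ContinuousLinearMap.id_apply]
    rw [← two_smul ℝ, smul_smul, smul_smul]
    have : (2 * w m)⁻¹ * 2 * w m = 1 := by field_simp
    rw [this, one_smul]
  exact DFunLike.congr_fun this a

variable (κ : ℕ)

theorem ev_delta (x : Torus) (m : ℕ) : ev κ hw x (delta m) = (w m)⁻¹ * cosT (κ * m) x :=
  lift_delta ..

theorem ev_mode (x : Torus) (m : ℕ) : ev κ hw x (mode w m) = cosT (κ * m) x := by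
  rw [mode, map_smul, ev_delta, smul_eq_mul, mul_inv_cancel_left₀ (hw.ne_zero m)]

theorem ev_delta_zero (x : Torus) : ev κ hw x (delta 0) = 1 := by
  rw [ev_delta, mul_zero, cosT_zero, hw.zero]; simp

theorem abs_ev_le (x : Torus) (a : EllOne) : |ev κ hw x a| ≤ ‖a‖ := by
  have := norm_lift_apply_le _ 1 (fun m => norm_cosT_div_le hw m (κ * m) x) a
  rwa [one_mul] at this

theorem hasSum_ev (x : Torus) (a : EllOne) :
    HasSum (fun m => a m * ((w m)⁻¹ * cosT (κ * m) x)) (ev κ hw x a) := hasSum_lift _ _ _ a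

/-- Point evaluations are multiplicative. By bilinearity and continuity this is the product-to-sum
formula on pairs of basis elements. -/
theorem ev_mulOp (x : Torus) (a b : EllOne) :
    ev κ hw x (mulOp hw a b) = ev κ hw x a * ev κ hw x b := by
  have h1 : ∀ m, (ev κ hw x).comp (mulOp hw (delta m)) = ev κ hw x (delta m) • ev κ hw x := by
    refine fun m => clm_ext fun n => ?_
    have e1 := hw.ne_zero m
    have e2 := hw.ne_zero n
    have e3 : Nat.dist (κ * m) (κ * n) = κ * Nat.dist m n := Nat.dist_mul_left κ m n
    rw [ContinuousLinearMap.comp_apply, mulOp_delta, deltaMul, map_smul, map_add, ev_mode, ev_mode,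
      smul_apply, ev_delta, ev_delta, smul_eq_mul, smul_eq_mul, mul_mul_mul_comm, cosT_mul,
      e3, mul_add κ]
    field_simp
  have h2 : (ev κ hw x).comp ((mulOp hw).flip b) = ev κ hw x b • ev κ hw x := by
    refine clm_ext fun m => ?_
    have := DFunLike.congr_fun (h1 m) b
    simp only [ContinuousLinearMap.comp_apply, smul_apply, smul_eq_mul] at this
    simp only [ContinuousLinearMap.comp_apply, ContinuousLinearMap.flip_apply, smul_apply,
      smul_eq_mul, this, mul_comm]
  have := DFunLike.congr_fun h2 a
  simp only [ContinuousLinearMap.comp_apply, ContinuousLinearMap.flip_apply, smul_apply,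
    smul_eq_mul] at this
  rw [this, mul_comm]

end

-- This gives the algebra of operators on sequences a unit of norm one, as the functional calculus
-- below requires.
instance : Nontrivial EllOne := ⟨delta 0, 0, fun h => by
  have := norm_delta 0
  rw [h, norm_zero] at this
  exact zero_ne_one this⟩

/-- A convergent real power series for `q` near `0`. -/
structure HasScalarSeries (q : ℝ → ℝ) (d : ℕ → ℝ) (r : ℝ) : Prop where
  pos : 0 < r
  summable : Summable fun n => |d n| * r ^ n
  hasSum : ∀ t, |t| ≤ r → HasSum (fun n => d n * t ^ n) (q t)

theorem exists_hasScalarSeries {q : ℝ → ℝ} (hq : AnalyticAt ℝ q 0) :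
    ∃ d r, HasScalarSeries q d r := by
  obtain ⟨p, R, hp⟩ := hq
  obtain ⟨r, hr0, hrR⟩ := ENNReal.lt_iff_exists_nnreal_btwn.1 hp.r_pos
  have hr0 : 0 < r := by exact_mod_cast hr0
  refine ⟨p.coeff, r, by exact_mod_cast hr0, ?_, fun t ht => ?_⟩
  · have := p.summable_norm_mul_pow (hrR.trans_le hp.r_le)
    refine this.congr fun n => ?_
    exact congrArg (· * (r : ℝ) ^ n) p.norm_apply_eq_norm_coef
  · have := hp.hasSum (y := t) (by
      rw [Metric.mem_eball, edist_zero_right]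
      refine lt_of_le_of_lt ?_ hrR
      rw [← ofReal_norm, Real.norm_eq_abs, ← ENNReal.ofReal_coe_nnreal]
      exact ENNReal.ofReal_le_ofReal ht)
    rw [zero_add] at this
    refine this.congr_fun fun n => ?_
    rw [FormalMultilinearSeries.apply_eq_pow_smul_coeff, smul_eq_mul, mul_comm]

namespace HasScalarSeries

open FormalMultilinearSeries

variable {q : ℝ → ℝ} {d : ℕ → ℝ} {r : ℝ} (h : HasScalarSeries q d r)
include h

theorem coeff_zero : d 0 = q 0 := by
  have h1 := h.hasSum 0 (by simpa using h.pos.le)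
  refine (hasSum_single 0 fun n hn => ?_).unique h1 |>.symm ▸ ?_
  · simp [hn]
  · simp

variable {A : Type*} [NormedRing A] [NormedAlgebra ℝ A] [NormOneClass A] [CompleteSpace A]

theorem analyticAt_ofScalarsSum : AnalyticAt ℝ (ofScalarsSum d : A → A) 0 := by
  obtain ⟨ρ, hρ⟩ : ∃ ρ : ℝ≥0, (ρ : ℝ) = r := ⟨⟨r, h.pos.le⟩, rfl⟩
  have hr : (ρ : ENNReal) ≤ (ofScalars A d).radius := by
    refine le_radius_of_summable_norm _ (h.summable.congr fun n => ?_)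
    rw [ofScalars_norm, hρ, Real.norm_eq_abs]
  have hρ0 : 0 < ρ := by
    have := h.pos
    rw [← hρ] at this
    exact_mod_cast this
  have hpos : 0 < (ofScalars A d).radius := lt_of_lt_of_le (ENNReal.coe_pos.2 hρ0) hr
  exact ⟨_, _, (ofScalars A d).hasFPowerSeriesOnBall hpos⟩

theorem hasSum_ofScalarsSum {T : A} (hT : ‖T‖ ≤ r) :
    HasSum (fun n => d n • T ^ n) (ofScalarsSum d T) := by
  rw [ofScalars_sum_eq]
  refine (Summable.of_norm_bounded h.summable fun n => ?_).hasSum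
  rw [norm_smul, Real.norm_eq_abs]
  gcongr
  exact (norm_pow_le _ _).trans (pow_le_pow_left₀ (norm_nonneg _) hT n)

theorem isBigO_ofScalarsSum_sub :
    (fun T : A => ofScalarsSum d T - d 0 • (1 : A)) =O[𝓝 0] fun T => ‖T‖ := by
  have := (h.analyticAt_ofScalarsSum (A := A)).differentiableAt.isBigO_sub
  simp only [ofScalarsSum_zero, sub_zero] at this
  exact this.norm_right

end HasScalarSeries

/-- Evaluation is continuous and multiplicative, so it passes through the power series term by term.
-/
theorem ev_ofScalarsSum {q : ℝ → ℝ} {d : ℕ → ℝ} {r : ℝ} (h : HasScalarSeries q d r)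
    {w : ℕ → ℝ} (hw : IsWeight w) (κ : ℕ) (x : Torus) {a : EllOne} (ha : ‖a‖ ^ 2 ≤ r) (b : EllOne) :
    ev κ hw x (FormalMultilinearSeries.ofScalarsSum d (mulOp hw a ^ 2) b) =
      q (ev κ hw x a ^ 2) * ev κ hw x b := by
  have hT : ‖mulOp hw a ^ 2‖ ≤ r := (norm_pow_le _ _).trans
    ((pow_le_pow_left₀ (norm_nonneg _) (norm_mulOp_le hw a) 2).trans ha)
  have hx : |ev κ hw x a ^ 2| ≤ r := by
    rw [abs_pow]
    exact (pow_le_pow_left₀ (abs_nonneg _) (abs_ev_le hw κ x a) 2).trans ha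
  have h1 := ((h.hasSum_ofScalarsSum hT).mapL (ContinuousLinearMap.apply ℝ EllOne b)).mapL
    (ev κ hw x)
  have h2 := (h.hasSum _ hx).mul_right (ev κ hw x b)
  refine h1.unique (h2.congr_fun fun n => ?_)
  have hpow : ∀ j, ev κ hw x ((mulOp hw a ^ j) b) = ev κ hw x a ^ j * ev κ hw x b := by
    intro j
    induction j with
    | zero => simp
    | succ j ih => rw [pow_succ', mul_apply_eq_comp, ev_mulOp, ih]; ring
  rw [ContinuousLinearMap.apply_apply, smul_apply, map_smul, ← pow_mul, hpow, smul_eq_mul, pow_mul]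
  ring

end NegDispersive

/-! ### The linear operator and the nonlinearity on sequences. -/

namespace NegDispersive

open EllOne
open FormalMultilinearSeries (ofScalarsSum)

/-- The removal of the constant term. -/
noncomputable def removeMean : EllOne →L[ℝ] EllOne :=
  diag (fun m => if m = 0 then 0 else 1) 1 fun m => by split_ifs <;> simp

/-- The symbol of `|D|^{-α}` on `cos (κ m x)`. -/
noncomputable def symb (α : ℝ) (κ m : ℕ) : ℝ := ((κ * m : ℕ) : ℝ) ^ (-α)

section symb

theorem symb_nonneg (α : ℝ) (κ m : ℕ) : 0 ≤ symb α κ m := by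
  rw [symb]; positivity

theorem symb_pos (α : ℝ) {κ m : ℕ} (hκ : κ ≠ 0) (hm : m ≠ 0) : 0 < symb α κ m :=
  Real.rpow_pos_of_pos (by exact_mod_cast Nat.pos_of_ne_zero (mul_ne_zero hκ hm)) _

variable {α : ℝ} (hα : 0 < α) (κ : ℕ)
include hα

theorem symb_zero : symb α κ 0 = 0 := by
  rw [symb, mul_zero, Nat.cast_zero, Real.zero_rpow (by linarith)]

theorem symb_le_one (m : ℕ) : symb α κ m ≤ 1 := by
  rcases Nat.eq_zero_or_pos (κ * m) with h | h
  · rw [symb, h, Nat.cast_zero, Real.zero_rpow (by linarith)]; exact zero_le_one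
  · exact Real.rpow_le_one_of_one_le_of_nonpos (by exact_mod_cast h) (by linarith)

theorem abs_symb_le (m : ℕ) : |symb α κ m| ≤ 1 :=
  (abs_of_nonneg (symb_nonneg α κ m)).trans_le (symb_le_one hα κ m)

/-- The operator `|D|^{-α}` on sequences. -/
noncomputable def fracOp : EllOne →L[ℝ] EllOne := diag (symb α κ) 1 (abs_symb_le hα κ)

variable {κ} (hκ : κ ≠ 0)
include hκ

theorem symb_ne {m n : ℕ} (hn : n ≠ 0) (hmn : m ≠ n) : symb α κ m ≠ symb α κ n := by
  rcases eq_or_ne m 0 with rfl | hm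
  · rw [symb_zero hα]; exact (symb_pos α hκ hn).ne
  · intro h
    have h2 := (Real.rpow_left_inj (Nat.cast_nonneg _) (Nat.cast_nonneg _)
      (neg_ne_zero.2 hα.ne')).1 h
    have h3 : κ * m = κ * n := by exact_mod_cast h2
    exact hmn (Nat.eq_of_mul_eq_mul_left (Nat.pos_of_ne_zero hκ) h3)

theorem tendsto_symb : Tendsto (symb α κ) atTop (𝓝 0) := by
  have h1 : Tendsto (fun m : ℕ => ((κ * m : ℕ) : ℝ)) atTop atTop :=
    tendsto_natCast_atTop_atTop.comp (tendsto_id.const_mul_atTop' (Nat.pos_of_ne_zero hκ))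
  exact (tendsto_rpow_neg_atTop hα).comp h1

end symb

/-- The coefficient functional of `cos (κ i x)`. -/
noncomputable def modeCoeff (w : ℕ → ℝ) (i : ℕ) : EllOne →L[ℝ] ℝ := (w i)⁻¹ • coord i

theorem modeCoeff_apply (w : ℕ → ℝ) (i : ℕ) (a : EllOne) : modeCoeff w i a = (w i)⁻¹ * a i := rfl

theorem mode_apply (w : ℕ → ℝ) (m n : ℕ) : mode w m n = if n = m then w m else 0 := by
  rw [mode, lp.coeFn_smul, Pi.smul_apply, delta_apply]; simp

theorem modeCoeff_mode {w : ℕ → ℝ} (hw : IsWeight w) (i m : ℕ) :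
    modeCoeff w i (mode w m) = if i = m then 1 else 0 := by
  rw [modeCoeff_apply, mode_apply]
  split_ifs with h
  · rw [h, inv_mul_cancel₀ (hw.ne_zero m)]
  · simp

theorem fracOp_apply {α : ℝ} (hα : 0 < α) (κ : ℕ) (a : EllOne) (m : ℕ) :
    fracOp hα κ a m = symb α κ m * a m := diag_apply ..

theorem fracOp_mode {α : ℝ} (hα : 0 < α) (κ : ℕ) (w : ℕ → ℝ) (m : ℕ) :
    fracOp hα κ (mode w m) = symb α κ m • mode w m := by
  ext n
  rw [fracOp_apply, lp.coeFn_smul, Pi.smul_apply, mode_apply]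
  split_ifs with h
  · rw [h]; simp
  · simp

theorem removeMean_apply (a : EllOne) (m : ℕ) : removeMean a m = if m = 0 then 0 else a m := by
  rw [removeMean, diag_apply]; split_ifs <;> simp

theorem removeMean_eq (a : EllOne) : removeMean a = a - a 0 • delta 0 := by
  ext m
  rw [removeMean_apply, lp.coeFn_sub, Pi.sub_apply, lp.coeFn_smul, Pi.smul_apply, delta_apply]
  split_ifs with h
  · simp [h]
  · simp

theorem removeMean_mode (w : ℕ → ℝ) (m : ℕ) :
    removeMean (mode w m) = if m = 0 then 0 else mode w m := by
  ext n
  rw [removeMean_apply]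
  split_ifs with h h' h'
  · rfl
  · rw [mode_apply, if_neg]; omega
  · rw [mode_apply, if_neg]; · rfl
    · omega
  · rfl

/-- The operator is diagonal, with entry -1 at i and symb m - symb i elsewhere. The latter never
vanish, by injectivity of the symbol, and tend to -symb i ≠ 0, so their inverses are bounded. -/
theorem exists_linearization {α : ℝ} (hα : 0 < α) {κ i : ℕ} (hκ : κ ≠ 0) (hi : i ≠ 0)
    {w : ℕ → ℝ} (hw : IsWeight w) : ∃ D : EllOne ≃L[ℝ] EllOne, ∀ y, D y =
      fracOp hα κ y - symb α κ i • y - modeCoeff w i y • mode w i := by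
  set d : ℕ → ℝ := fun m => if m = i then -1 else symb α κ m - symb α κ i with hd
  have hb : ∀ m, |d m| ≤ 1 := fun m => by
    simp only [hd]
    split_ifs
    · simp
    · have h1 := symb_nonneg α κ m
      have h2 := symb_nonneg α κ i
      have h3 := symb_le_one hα κ m
      have h4 := symb_le_one hα κ i
      exact abs_le.2 ⟨by linarith, by linarith⟩
  have h0 : ∀ m, d m ≠ 0 := fun m => by
    simp only [hd]
    split_ifs with h
    · norm_num
    · exact sub_ne_zero.2 (symb_ne hα hκ hi h)
  have hlim : Tendsto d atTop (𝓝 (0 - symb α κ i)) := by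
    refine ((tendsto_symb hα hκ).sub_const _).congr' ?_
    filter_upwards [eventually_gt_atTop i] with m hm
    simp [hd, hm.ne']
  have hlim' := hlim.inv₀ (by rw [zero_sub]; exact neg_ne_zero.2 (symb_pos α hκ hi).ne')
  obtain ⟨C', hC'⟩ := (Metric.isBounded_range_of_tendsto _ hlim').exists_norm_le
  refine ⟨diagEquiv d 1 C' hb (fun m => hC' _ ⟨m, rfl⟩) h0, fun y => ?_⟩
  ext n
  change diag d 1 hb y n = _
  rw [diag_apply, lp.coeFn_sub, Pi.sub_apply, lp.coeFn_sub, Pi.sub_apply, lp.coeFn_smul,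
    lp.coeFn_smul, Pi.smul_apply, Pi.smul_apply, fracOp_apply, mode_apply, modeCoeff_apply]
  simp only [hd, smul_eq_mul]
  split_ifs with h
  · rw [h]
    have := hw.ne_zero i
    field_simp
    ring
  · ring

section nonlin

variable {w : ℕ → ℝ} (hw : IsWeight w) (d : ℕ → ℝ) (j : ℕ)

/-- The nonlinearity `x ↦ xʲ q(x²)`, without its mean, where `q` has the coefficients `d`. -/
noncomputable def nonlin (a : EllOne) : EllOne :=
  removeMean ((mulOp hw a ^ j * ofScalarsSum d (mulOp hw a ^ 2)) (delta 0))

/-- The nonlinearity at `s a`, divided by `s²`. -/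
noncomputable def scaledNonlin (z : ℝ × EllOne) : EllOne :=
  z.1 ^ (j - 2) •
    removeMean ((mulOp hw z.2 ^ j * ofScalarsSum d (z.1 ^ 2 • mulOp hw z.2 ^ 2)) (delta 0))

theorem nonlin_smul (hj : 2 ≤ j) (s : ℝ) (a : EllOne) :
    nonlin hw d j (s • a) = s ^ 2 • scaledNonlin hw d j (s, a) := by
  rw [nonlin, scaledNonlin, map_smul, smul_pow, smul_pow, smul_mul_assoc, smul_apply, map_smul,
    smul_smul, ← pow_add, Nat.add_sub_cancel' hj]

theorem nonlin_neg (a : EllOne) : nonlin hw d j (-a) = (-1 : ℝ) ^ j • nonlin hw d j a := by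
  rw [nonlin, nonlin, map_neg, neg_sq, ← neg_one_smul ℝ, smul_pow, smul_mul_assoc, smul_apply,
    map_smul]

variable {d} {q : ℝ → ℝ} {r : ℝ} (hq : HasScalarSeries q d r)
include hq

/-- At s = 0 the argument of the power series is 0 whatever e is, so no smallness of e is needed. -/
theorem scaledNonlin_analyticAt (e : EllOne) : AnalyticAt ℝ (scaledNonlin hw d j) (0, e) := by
  have hM : AnalyticAt ℝ (fun z : ℝ × EllOne => mulOp hw z.2) (0, e) :=
    ((mulOp hw).comp (ContinuousLinearMap.snd ℝ ℝ EllOne)).analyticAt _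
  have hin : AnalyticAt ℝ (fun z : ℝ × EllOne => z.1 ^ 2 • mulOp hw z.2 ^ 2) (0, e) :=
    (analyticAt_fst.pow 2).smul (hM.pow 2)
  have hQ : AnalyticAt ℝ (fun z : ℝ × EllOne =>
      (ofScalarsSum d (z.1 ^ 2 • mulOp hw z.2 ^ 2) : EllOne →L[ℝ] EllOne)) (0, e) := by
    refine AnalyticAt.fun_comp (g := fun T => (ofScalarsSum d T : EllOne →L[ℝ] EllOne)) ?_ hin
    simpa using hq.analyticAt_ofScalarsSum
  have hprod := (hM.pow j).mul hQ
  exact (analyticAt_fst.pow (j - 2)).smul (AnalyticAt.fun_comp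
    (g := removeMean.comp (ContinuousLinearMap.apply ℝ EllOne (delta 0)))
    (ContinuousLinearMap.analyticAt _ _) hprod)

theorem nonlin_sub_isBigO :
    (fun a => nonlin hw d j a - d 0 • removeMean ((mulOp hw a ^ j) (delta 0))) =O[𝓝 0]
      fun a => ‖a‖ ^ (j + 2) := by
  have h1 : Tendsto (fun a => mulOp hw a ^ 2) (𝓝 0) (𝓝 0) :=
    Continuous.tendsto' (by fun_prop) _ _ (by simp)
  have hM : (fun a => mulOp hw a) =O[𝓝 0] fun a => ‖a‖ :=
    IsBigO.of_bound 1 (Eventually.of_forall fun a => by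
      simpa using norm_mulOp_le hw a)
  have h2 := (hq.isBigO_ofScalarsSum_sub (A := EllOne →L[ℝ] EllOne)).comp_tendsto h1
  have h3 : (fun a => ofScalarsSum d (mulOp hw a ^ 2) - d 0 • (1 : EllOne →L[ℝ] EllOne)) =O[𝓝 0]
      fun a => ‖a‖ ^ 2 := h2.trans (hM.pow 2).norm_left
  have h4 := (hM.pow j).mul h3
  have h5 := ((removeMean.comp (ContinuousLinearMap.apply ℝ EllOne (delta 0))).isBigO_comp
    _ (𝓝 0)).trans h4
  refine (h5.congr_left fun a => ?_).congr_right fun a => (pow_add _ _ _).symm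
  rw [nonlin, mul_sub, ContinuousLinearMap.comp_apply, ContinuousLinearMap.apply_apply,
    sub_apply, map_sub, mul_smul_comm, mul_one, smul_apply, map_smul]

theorem nonlin_isBigO (hj : 2 ≤ j) : nonlin hw d j =O[𝓝 0] fun a => ‖a‖ ^ 2 := by
  have hM : (fun a => mulOp hw a) =O[𝓝 0] fun a => ‖a‖ :=
    IsBigO.of_bound 1 (Eventually.of_forall fun a => by
      simpa using norm_mulOp_le hw a)
  have h1 := ((removeMean.comp (ContinuousLinearMap.apply ℝ EllOne (delta 0))).isBigO_comp
    (fun a => mulOp hw a ^ j) (𝓝 0)).trans (hM.pow j)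
  have hle : ∀ n, 2 ≤ n → (fun a : EllOne => ‖a‖ ^ n) =O[𝓝 0] fun a => ‖a‖ ^ 2 := fun n hn => by
    have h2 : (fun a : EllOne => ‖a‖ ^ (n - 2)) =O[𝓝 0] fun _ => (1 : ℝ) :=
      Continuous.continuousAt (by fun_prop) |>.isBigO_one ℝ
    have h3 := (isBigO_refl (fun a : EllOne => ‖a‖ ^ 2) (𝓝 0)).mul h2
    refine (h3.congr_left fun a => ?_).congr_right fun a => mul_one _
    rw [← pow_add, Nat.add_sub_cancel' hn]
  have h2 := ((nonlin_sub_isBigO hw j hq).trans (hle _ (by omega))).add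
    ((h1.const_smul_left (d 0)).trans (hle _ hj))
  exact h2.congr_left fun a => sub_add_cancel _ _

/-- The witness b represents the nonlinearity before its mean is removed, and b 0 is that mean; the
steady equation refers to both. -/
theorem ev_nonlin {κ : ℕ} {a : EllOne} (ha : ‖a‖ ^ 2 ≤ r) : ∃ b : EllOne,
    (∀ x, ev κ hw x b = ev κ hw x a ^ j * q (ev κ hw x a ^ 2)) ∧
    ∀ x, ev κ hw x (nonlin hw d j a) = ev κ hw x b - b 0 := by
  refine ⟨(mulOp hw a ^ j * ofScalarsSum d (mulOp hw a ^ 2)) (delta 0), fun x => ?_, fun x => ?_⟩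
  · have hpow : ∀ (n : ℕ) b, ev κ hw x ((mulOp hw a ^ n) b) = ev κ hw x a ^ n * ev κ hw x b := by
      intro n b
      induction n with
      | zero => simp
      | succ n ih => rw [pow_succ', mul_apply_eq_comp, ev_mulOp, ih]; ring
    rw [mul_apply_eq_comp, hpow, ev_ofScalarsSum hq hw κ x ha, ev_delta_zero, mul_one]
  · rw [nonlin, removeMean_eq, map_sub, map_smul, ev_delta_zero, smul_eq_mul, mul_one]

end nonlin

end NegDispersive

/-! ### Orthogonality of cosines and translation by half a period. -/

namespace NegDispersive

open EllOne
open FormalMultilinearSeries (ofScalarsSum)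

theorem integrable_cont (f : C(Torus, ℝ)) : Integrable f :=
  f.continuous.integrable_of_hasCompactSupport (HasCompactSupport.of_compactSpace _)

theorem volume_real_univ_torus : (volume : Measure Torus).real Set.univ = 2 * π := by
  rw [Measure.real, AddCircle.measure_univ, ENNReal.toReal_ofReal Real.two_pi_pos.le]

/-- The integral over the torus as a bounded functional on the continuous functions. -/
noncomputable def integralCont : C(Torus, ℝ) →L[ℝ] ℝ :=
  LinearMap.mkContinuous
    { toFun := fun f => ∫ x, f x
      map_add' := fun f g => integral_add (integrable_cont f) (integrable_cont g)
      map_smul' := fun r f => integral_const_mul r f }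
    (2 * π) fun f => by
      have h := norm_integral_le_of_norm_le_const (μ := (volume : Measure Torus)) (f := f)
        (Eventually.of_forall f.norm_coe_le_norm)
      rw [volume_real_univ_torus] at h
      exact h.trans_eq (mul_comm _ _)

theorem integralCont_apply (f : C(Torus, ℝ)) : integralCont f = ∫ x, f x := rfl

theorem integral_cosT (m : ℕ) : ∫ x, cosT m x = if m = 0 then 2 * π else 0 := by
  split_ifs with h
  · subst h
    rw [integral_congr_ae (Eventually.of_forall cosT_zero), integral_const, volume_real_univ_torus, smul_eq_mul, mul_one]
  · have := integral_cosFun ⟨m, Nat.pos_of_ne_zero h⟩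
    rw [← this]
    exact integral_congr_ae (Eventually.of_forall (cosT_eq_cosFun ⟨m, Nat.pos_of_ne_zero h⟩))

theorem integral_cosT_mul (m n : ℕ) : ∫ x, cosT m x * cosT n x =
    if m = n then (if n = 0 then 2 * π else π) else 0 := by
  simp only [cosT_mul]
  rw [integral_div, integral_add (integrable_cont _) (integrable_cont _), integral_cosT,
    integral_cosT]
  rcases eq_or_ne m n with rfl | h
  · rw [Nat.dist_self, if_pos rfl, if_pos rfl]
    split_ifs <;> first | omega | ring
  · have h1 : Nat.dist m n ≠ 0 := fun h0 => h (Nat.eq_of_dist_eq_zero h0)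
    rw [if_neg h1, if_neg (by omega), if_neg h]
    simp

variable {w : ℕ → ℝ} (hw : IsWeight w)

/-- The continuous function represented by a sequence. -/
noncomputable def synth (κ : ℕ) : EllOne →L[ℝ] C(Torus, ℝ) :=
  lift (fun m => (w m)⁻¹ • cosT (κ * m)) 1 fun m =>
    (ContinuousMap.norm_le _ zero_le_one).2 fun x => norm_cosT_div_le hw m (κ * m) x

theorem synth_apply (κ : ℕ) (a : EllOne) (x : Torus) : synth hw κ a x = ev κ hw x a := by
  have : (ContinuousMap.evalCLM ℝ x).comp (synth hw κ) = ev κ hw x :=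
    clm_ext fun m => by
      rw [ContinuousLinearMap.comp_apply, synth, lift_delta, ev_delta]; rfl
  exact DFunLike.congr_fun this a

variable {κ : ℕ} (hκ : κ ≠ 0)
include hκ

theorem integral_ev_mul_cosT (n : ℕ) (a : EllOne) :
    ∫ x, ev κ hw x a * cosT (κ * n) x = (w n)⁻¹ * a n * if n = 0 then 2 * π else π := by
  have h : integralCont.comp (((ContinuousLinearMap.mul ℝ C(Torus, ℝ)).flip
      (cosT (κ * n))).comp (synth hw κ)) = ((w n)⁻¹ * if n = 0 then 2 * π else π) • coord n := by
    refine clm_ext fun m => ?_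
    simp only [ContinuousLinearMap.comp_apply, ContinuousLinearMap.flip_apply,
      ContinuousLinearMap.mul_apply', synth, lift_delta, map_smul,
      integralCont_apply, ContinuousMap.mul_apply, integral_cosT_mul, smul_apply, coord_apply,
      delta_apply, smul_eq_mul]
    by_cases hmn : m = n
    · subst hmn
      simp [hκ]
    · have h1 : κ * m ≠ κ * n := fun h => hmn (Nat.eq_of_mul_eq_mul_left (Nat.pos_of_ne_zero hκ) h)
      rw [if_neg h1, if_neg (Ne.symm hmn)]
      simp
  have h1 := DFunLike.congr_fun h a
  simp only [ContinuousLinearMap.comp_apply, ContinuousLinearMap.flip_apply,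
    ContinuousLinearMap.mul_apply', integralCont_apply, ContinuousMap.mul_apply, synth_apply,
    smul_apply, coord_apply, smul_eq_mul] at h1
  rw [h1]; ring

theorem ev_injective {a b : EllOne} (h : ∀ x, ev κ hw x a = ev κ hw x b) : a = b := by
  ext n
  have h1 := integral_ev_mul_cosT hw hκ n a
  have h2 := integral_ev_mul_cosT hw hκ n b
  simp only [h] at h1
  rw [h1] at h2
  have h3 : (if n = 0 then 2 * π else π) ≠ 0 := by
    have := Real.pi_ne_zero
    split_ifs <;> simp
  exact mul_left_cancel₀ (inv_ne_zero (hw.ne_zero n)) (mul_right_cancel₀ h3 h2)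

theorem integral_ev (a : EllOne) : ∫ x, ev κ hw x a = a 0 * (2 * π) := by
  have := integral_ev_mul_cosT hw hκ 0 a
  simpa [cosT_zero, hw.zero] using this

theorem average_ev (a : EllOne) : ⨍ x, ev κ hw x a = a 0 := by
  rw [average_eq, volume_real_univ_torus, integral_ev hw hκ, smul_eq_mul]
  have := Real.pi_ne_zero
  field_simp

theorem cosineCoeff_ev (i : ℕ) (k : ℕ+) (hk : (k : ℕ) = κ * i) (a : EllOne) :
    cosineCoeff (fun x => ev κ hw x a) k = modeCoeff w i a := by
  have hi : i ≠ 0 := by rintro rfl; simp at hk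
  have := integral_ev_mul_cosT hw hκ i a
  rw [cosineCoeff]
  simp only [← cosT_eq_cosFun, hk, this, if_neg hi, modeCoeff_apply]
  have := Real.pi_ne_zero
  field_simp

omit hκ in
theorem nonlin_zero_coeff (d : ℕ → ℝ) (j : ℕ) (a : EllOne) : nonlin hw d j a 0 = 0 := by
  rw [nonlin, removeMean_apply, if_pos rfl]

omit hκ in
-- Nonlinearities without their means are naturally compared only up to a constant; the zeroth
-- coefficients then show that the constant is 0.
theorem ext_of_ev_eq_add_const {a b : EllOne} {C : ℝ} (hκ : κ ≠ 0)
    (h : ∀ x, ev κ hw x a = ev κ hw x b + C) (h0 : a 0 = b 0) : a = b := by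
  have h1 : a = b + C • delta 0 := by
    refine ev_injective hw hκ fun x => ?_
    rw [h, map_add, map_smul, ev_delta_zero, smul_eq_mul, mul_one]
  have h2 : C = 0 := by
    rw [h1, lp.coeFn_add, Pi.add_apply, lp.coeFn_smul, Pi.smul_apply, delta_apply] at h0
    simpa using h0
  rw [h1, h2, zero_smul, add_zero]

/-- The coefficients of the translate by half the period. -/
noncomputable def halfShift : EllOne →L[ℝ] EllOne :=
  diag (fun m => (-1) ^ m) 1 fun m => by simp

omit hκ in
theorem halfShift_apply (a : EllOne) (m : ℕ) : halfShift a m = (-1) ^ m * a m := diag_apply ..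

theorem ev_halfShift (x : Torus) (a : EllOne) :
    ev κ hw x (halfShift a) = ev κ hw (x + ((π / κ : ℝ) : Torus)) a := by
  have h : (ev κ hw x).comp halfShift = ev κ hw (x + ((π / κ : ℝ) : Torus)) := by
    refine clm_ext fun m => ?_
    rw [ContinuousLinearMap.comp_apply, halfShift, diag_delta, map_smul, ev_delta, ev_delta,
      smul_eq_mul, mul_left_comm]
    congr 1
    induction x using QuotientAddGroup.induction_on with | H t => ?_
    change _ * cosT (κ * m) (t : Torus) = cosT (κ * m) ((t + π / κ : ℝ) : Torus)
    have hκ' : (κ : ℝ) ≠ 0 := by exact_mod_cast hκ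
    have h1 : ((κ * m : ℕ) : ℝ) * (t + π / κ) = ((κ * m : ℕ) : ℝ) * t + m * π := by
      push_cast; field_simp
    rw [cosT_coe, cosT_coe, h1, Real.cos_add_nat_mul_pi]
  exact DFunLike.congr_fun h a

/-- A translation commutes with a nonlinearity that acts pointwise, and it preserves the mean. -/
theorem nonlin_halfShift {d : ℕ → ℝ} (j : ℕ) {q : ℝ → ℝ} {r : ℝ} (hq : HasScalarSeries q d r) :
    ∀ᶠ a in 𝓝 0, nonlin hw d j (halfShift a) = halfShift (nonlin hw d j a) := by
  have e1 : ∀ᶠ a : EllOne in 𝓝 0, ‖a‖ ^ 2 < r := by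
    have : Tendsto (fun a : EllOne => ‖a‖ ^ 2) (𝓝 0) (𝓝 0) :=
      Continuous.tendsto' (by fun_prop) _ _ (by simp)
    exact this.eventually_lt_const hq.pos
  have e2 : Tendsto (fun a : EllOne => halfShift a) (𝓝 0) (𝓝 0) :=
    halfShift.continuous.tendsto' _ _ (map_zero _)
  filter_upwards [e1, e2.eventually e1] with a h1 h2
  obtain ⟨b, hb, hb'⟩ := ev_nonlin hw j hq (κ := κ) h1.le
  obtain ⟨b', hc, hc'⟩ := ev_nonlin hw j hq (κ := κ) h2.le
  refine ext_of_ev_eq_add_const hw (C := b 0 - b' 0) hκ (fun x => ?_) ?_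
  · rw [ev_halfShift hw hκ, hb', hc', hb, hc, ev_halfShift hw hκ]; ring
  · rw [halfShift_apply, nonlin_zero_coeff, nonlin_zero_coeff]; simp

end NegDispersive

/-! ### The bifurcation curve of sequences and its expansions. -/

namespace NegDispersive

open EllOne
open FormalMultilinearSeries (ofScalarsSum)

/-- The steady equation for sequences. -/
def Solves {α : ℝ} (hα : 0 < α) (κ : ℕ) {w : ℕ → ℝ} (hw : IsWeight w) (d : ℕ → ℝ) (j : ℕ)
    (a : EllOne) (c : ℝ) : Prop :=
  fracOp hα κ a - c • a + nonlin hw d j a = 0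

/-- A curve of solutions of the sequence equation through the trivial solution, parametrised by the
coefficient of the `i`-th mode, that exhausts the nontrivial solutions nearby. -/
structure IsModeCurve {α : ℝ} (hα : 0 < α) (κ i : ℕ) {w : ℕ → ℝ} (hw : IsWeight w) (d : ℕ → ℝ)
    (j : ℕ) (φ : ℝ → EllOne) (c : ℝ → ℝ) : Prop where
  analytic_profile : AnalyticAt ℝ φ 0
  analytic_speed : AnalyticAt ℝ c 0
  profile_zero : φ 0 = 0
  speed_zero : c 0 = symb α κ i
  coeff : ∀ s, modeCoeff w i (φ s) = s
  solves : ∀ᶠ s in 𝓝 0, Solves hα κ hw d j (φ s) (c s)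
  isBigO : (fun s => φ s - s • mode w i) =O[𝓝 0] (fun s : ℝ => s ^ 2)
  exhausts : ∀ᶠ z : EllOne × ℝ in 𝓝 (0, symb α κ i), Solves hα κ hw d j z.1 z.2 → z.1 ≠ 0 →
    z.1 = φ (modeCoeff w i z.1) ∧ z.2 = c (modeCoeff w i z.1)

section

variable {α : ℝ} (hα : 0 < α) {κ i : ℕ} (hκ : κ ≠ 0) (hi : i ≠ 0) {w : ℕ → ℝ} (hw : IsWeight w)
  {d : ℕ → ℝ} {j : ℕ} (hj : 2 ≤ j) {q : ℝ → ℝ} {r : ℝ} (hq : HasScalarSeries q d r)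

include hw in
theorem modeCoeff_mode_self : modeCoeff w i (mode w i) = 1 := by
  rw [modeCoeff_mode hw, if_pos rfl]

theorem modeCoeff_fracOp (y : EllOne) :
    modeCoeff w i (fracOp hα κ y) = symb α κ i * modeCoeff w i y := by
  rw [modeCoeff_apply, modeCoeff_apply, fracOp_apply]; ring

include hκ hi hj hq in
theorem exists_isModeCurve : ∃ φ c, IsModeCurve hα κ i hw d j φ c := by
  obtain ⟨D, hD⟩ := exists_linearization hα hκ hi hw
  obtain ⟨φ, c, h1, h2, h3, h4, h5, h6, h7, h8⟩ := exists_bifurcation_curve (fracOp hα κ)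
    (modeCoeff w i) (mode w i) (symb α κ i) (modeCoeff_mode_self hw) (fracOp_mode hα κ w i) D hD
    (nonlin hw d j) (scaledNonlin hw d j) (scaledNonlin_analyticAt hw j hq _)
    (nonlin_smul hw d j hj) (nonlin_isBigO hw j hq hj)
  exact ⟨φ, c, h1, h2, h3, h4, h5, h6, h7, h8⟩

variable {hα hw} {φ : ℝ → EllOne} {c : ℝ → ℝ}

theorem IsModeCurve.symm (h : IsModeCurve hα κ i hw d j φ c) (S : EllOne →L[ℝ] EllOne)
    (hℓS : ∀ y, modeCoeff w i (S y) = - modeCoeff w i y)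
    (hLS : ∀ y, fracOp hα κ (S y) = S (fracOp hα κ y))
    (hNS : ∀ᶠ y in 𝓝 0, nonlin hw d j (S y) = S (nonlin hw d j y)) :
    ∀ᶠ s in 𝓝 0, φ (-s) = S (φ s) ∧ c (-s) = c s :=
  bifurcation_curve_symm (fracOp hα κ) (modeCoeff w i) (symb α κ i) (nonlin hw d j) φ c
    h.analytic_profile.continuousAt h.analytic_speed.continuousAt h.profile_zero h.speed_zero
    h.coeff h.solves h.exhausts S hℓS hLS hNS

include hκ hq in
/-- The speed is an even function of the amplitude. -/
theorem IsModeCurve.speed_even (h : IsModeCurve hα κ 1 hw d j φ c) :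
    ∀ᶠ s in 𝓝 0, c (-s) = c s := by
  -- Translation by π/κ sends cos κx to -cos κx, so it reverses the kernel when i = 1.
  refine (h.symm halfShift (fun y => ?_) (fun y => ?_) (nonlin_halfShift hw hκ j hq)).mono
    fun s hs => hs.2
  · rw [modeCoeff_apply, modeCoeff_apply, halfShift_apply]; ring
  · ext m
    rw [fracOp_apply, halfShift_apply, halfShift_apply, fracOp_apply]; ring

/-- For an odd nonlinearity the profile is an odd function of the amplitude. -/
theorem IsModeCurve.profile_odd (h : IsModeCurve hα κ i hw d j φ c) (hodd : Odd j) :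
    ∀ᶠ s in 𝓝 0, φ (-s) = - φ s := by
  refine (h.symm (-ContinuousLinearMap.id ℝ EllOne) (fun y => ?_) (fun y => ?_)
    (Eventually.of_forall fun y => ?_)).mono fun s hs => ?_
  · simp
  · simp
  · simp only [_root_.neg_apply, ContinuousLinearMap.id_apply, nonlin_neg,
      hodd.neg_one_pow, neg_smul, one_smul]
  · simpa using hs.1

theorem IsModeCurve.speed_mul (h : IsModeCurve hα κ i hw d j φ c) :
    ∀ᶠ s in 𝓝 0, (c s - symb α κ i) * s = modeCoeff w i (nonlin hw d j (φ s)) := by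
  filter_upwards [h.solves] with s hs
  have := bifurcation_curve_speed (fracOp hα κ) (modeCoeff w i) (symb α κ i)
    (modeCoeff_fracOp hα) (nonlin hw d j) hs
  rwa [h.coeff] at this

theorem IsModeCurve.profile_isBigO (h : IsModeCurve hα κ i hw d j φ c) :
    φ =O[𝓝 0] fun s : ℝ => s ^ 1 := by
  have := h.analytic_profile.differentiableAt.isBigO_sub
  simpa [h.profile_zero] using this

-- Analyticity gives O(s), and evenness improves it to O(s²).
include hκ hq in
theorem IsModeCurve.speed_isBigO (h : IsModeCurve hα κ 1 hw d j φ c) :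
    (fun s => c s - symb α κ 1) =O[𝓝 0] fun s : ℝ => s ^ 2 := by
  refine isBigO_pow_succ_of_parity 1 (h.analytic_speed.sub analyticAt_const) ?_ ?_
  · have := h.analytic_speed.differentiableAt.isBigO_sub
    simpa [h.speed_zero] using this
  · filter_upwards [h.speed_even hκ hq] with s hs
    rw [hs]; simp

theorem isBigO_pow_of_le {m n : ℕ} (hmn : m ≤ n) :
    (fun s : ℝ => s ^ n) =O[𝓝 0] fun s : ℝ => s ^ m := by
  have h1 : (fun s : ℝ => s ^ (n - m)) =O[𝓝 0] fun _ => (1 : ℝ) :=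
    (continuous_pow _).continuousAt.isBigO_one ℝ
  refine ((isBigO_refl (fun s : ℝ => s ^ m) (𝓝 0)).mul h1).congr (fun s => ?_) fun s => mul_one _
  rw [← pow_add, Nat.add_sub_cancel' hmn]

theorem isBigO_pow_smul_const {E : Type*} [NormedAddCommGroup E] [NormedSpace ℝ E] (n : ℕ) (v : E) :
    (fun s : ℝ => s ^ n • v) =O[𝓝 0] fun s : ℝ => s ^ n :=
  IsBigO.of_bound ‖v‖ (Eventually.of_forall fun s => by rw [norm_smul, mul_comm])

theorem mulOp_isBigO (hw : IsWeight w) {f g : ℝ → EllOne} {m n : ℕ}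
    (hf : f =O[𝓝 0] fun s : ℝ => s ^ m) (hg : g =O[𝓝 0] fun s : ℝ => s ^ n) :
    (fun s => mulOp hw (f s) (g s)) =O[𝓝 0] fun s : ℝ => s ^ (m + n) := by
  have h1 : (fun s => mulOp hw (f s) (g s)) =O[𝓝 0] fun s => ‖f s‖ * ‖g s‖ :=
    IsBigO.of_bound 1 (Eventually.of_forall fun s => by
      rw [one_mul, norm_mul, norm_norm, norm_norm]
      refine ((mulOp hw (f s)).le_opNorm _).trans ?_
      gcongr
      exact norm_mulOp_le hw _)
  exact (h1.trans (hf.norm_left.mul hg.norm_left)).congr_right fun s => (pow_add _ _ _).symm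

theorem IsModeCurve.nonlin_sub_isBigO (h : IsModeCurve hα κ i hw d j φ c)
    (hq : HasScalarSeries q d r) :
    (fun s => nonlin hw d j (φ s) - d 0 • removeMean ((mulOp hw (φ s) ^ j) (delta 0))) =O[𝓝 0]
      fun s : ℝ => s ^ (j + 2) := by
  have h1 : Tendsto φ (𝓝 0) (𝓝 0) := by
    simpa [ContinuousAt, h.profile_zero] using h.analytic_profile.continuousAt
  have h2 := (NegDispersive.nonlin_sub_isBigO hw j hq).comp_tendsto h1
  have h3 : (fun s => ‖φ s‖ ^ (j + 2)) =O[𝓝 0] fun s : ℝ => s ^ (j + 2) := by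
    have := h.profile_isBigO.norm_left.pow (j + 2)
    simpa using this
  exact h2.trans h3

theorem mulOp_sq_delta_zero (a : EllOne) : (mulOp hw a ^ 2) (delta 0) = mulOp hw a a := by
  rw [pow_two, mul_apply_eq_comp, mulOp_zero_mode]

theorem mulOp_cube_delta_zero (a : EllOne) :
    (mulOp hw a ^ 3) (delta 0) = mulOp hw a (mulOp hw a a) := by
  rw [pow_succ', mul_apply_eq_comp, mulOp_sq_delta_zero]

theorem mulOp_mode_one_one : mulOp hw (mode w 1) (mode w 1) =
    (1 / 2 : ℝ) • (mode w 2 + mode w 0) := by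
  rw [mulOp_mode]; rfl

theorem mulOp_mode_one_two : mulOp hw (mode w 1) (mode w 2) =
    (1 / 2 : ℝ) • (mode w 3 + mode w 1) := by
  rw [mulOp_mode]; rfl

theorem mulOp_mode_two_one : mulOp hw (mode w 2) (mode w 1) =
    (1 / 2 : ℝ) • (mode w 3 + mode w 1) := by
  rw [mulOp_mode]; rfl

theorem mulOp_mode_two_two : mulOp hw (mode w 2) (mode w 2) =
    (1 / 2 : ℝ) • (mode w 4 + mode w 0) := by
  rw [mulOp_mode]; rfl

theorem mulOp_mode_one_zero : mulOp hw (mode w 1) (mode w 0) = mode w 1 := by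
  rw [mulOp_mode]
  simp only [add_zero, Nat.dist_zero_right, ← two_smul ℝ, smul_smul]
  norm_num

/-- With e = `mode w 1`, the difference φφ - s² ee is (φ - se)φ + se(φ - se), and each product is
O(s³). -/
theorem IsModeCurve.mulOp_sub_isBigO (h : IsModeCurve hα κ 1 hw d j φ c) :
    (fun s => mulOp hw (φ s) (φ s) - s ^ 2 • mulOp hw (mode w 1) (mode w 1)) =O[𝓝 0]
      fun s : ℝ => s ^ 3 := by
  have hχ := h.isBigO
  have hse : (fun s : ℝ => s • mode w 1) =O[𝓝 0] fun s : ℝ => s ^ 1 := by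
    simpa only [pow_one] using isBigO_pow_smul_const 1 (mode w 1)
  have h1 : _ =O[𝓝 0] fun s : ℝ => s ^ 3 := mulOp_isBigO hw hχ h.profile_isBigO
  have h2 : _ =O[𝓝 0] fun s : ℝ => s ^ 3 := mulOp_isBigO hw hse hχ
  refine (h1.add h2).congr_left fun s => ?_
  simp only [map_sub, map_smul, _root_.sub_apply, _root_.smul_apply, smul_smul]
  module

include hκ hq in
/-- Leading order of the profile for the nonlinearity `x² q(x²)`. -/
theorem IsModeCurve.profile_sub_isBigO_two (h : IsModeCurve hα κ 1 hw d 2 φ c) :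
    (fun s => φ s - (s • mode w 1 +
      (s ^ 2 * (d 0 / 2 / (symb α κ 1 - symb α κ 2))) • mode w 2)) =O[𝓝 0]
        fun s : ℝ => s ^ 3 := by
  obtain ⟨D, hD⟩ := exists_linearization hα hκ one_ne_zero hw
  have hne : symb α κ 1 - symb α κ 2 ≠ 0 :=
    sub_ne_zero.2 (symb_ne hα hκ two_ne_zero (by norm_num))
  have hN : (fun s => nonlin hw d 2 (φ s) - s ^ 2 • ((d 0 / 2) • mode w 2)) =O[𝓝 0]
      fun s : ℝ => s ^ (2 + 1) := by
    have h1 := h.nonlin_sub_isBigO hq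
    simp only [mulOp_sq_delta_zero] at h1
    have h2 := (((d 0) • removeMean).isBigO_comp _ (𝓝 0)).trans h.mulOp_sub_isBigO
    refine ((h1.trans (isBigO_pow_of_le (by norm_num))).add h2).congr_left fun s => ?_
    rw [mulOp_mode_one_one]
    simp only [_root_.smul_apply, map_sub, map_smul, map_add, removeMean_mode]
    simp only [if_pos, if_neg, two_ne_zero, not_false_eq_true]
    module
  have := bifurcation_curve_isBigO (fracOp hα κ)
    (modeCoeff w 1) (mode w 1) (symb α κ 1) (modeCoeff_mode_self hw) (fracOp_mode hα κ w 1) D hD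
    (nonlin hw d 2) φ c h.coeff h.solves 2
    -- On this mode D acts as symb 2 - symb 1, and `bifurcation_curve_isBigO` adds s² u to the
    -- profile; hence the minus sign.
    (-(d 0 / 2 / (symb α κ 1 - symb α κ 2)) • mode w 2) ((d 0 / 2) • mode w 2)
    (by rw [map_smul, modeCoeff_mode hw]; simp)
    (by
      rw [map_smul, hD, fracOp_mode, map_smul, modeCoeff_mode hw]
      simp only [if_neg (show (1 : ℕ) ≠ 2 by norm_num), zero_smul, sub_zero, smul_zero, ← sub_smul,
        smul_smul]
      congr 1
      field_simp
      ring) hN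
    ((((h.speed_isBigO hκ hq).smul h.isBigO).congr_right fun s => (pow_add s 2 2).symm).trans
      (isBigO_pow_of_le (by norm_num)))
  refine this.congr_left fun s => ?_
  module

/-- Division by s leaves O(s³), and evenness raises this to O(s⁴). -/
theorem isBigO_speed_of_isBigO_three {μ b : ℝ} (hc : AnalyticAt ℝ c 0) (hc0 : c 0 = μ)
    (heven : ∀ᶠ s in 𝓝 0, c (-s) = c s)
    (h : (fun s => (c s - μ) * s - s ^ 3 * b) =O[𝓝 0] fun s : ℝ => s ^ 4) :
    (fun s => c s - (μ + s ^ 2 * b)) =O[𝓝 0] fun s : ℝ => s ^ 4 := by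
  refine isBigO_pow_succ_of_parity 3 (hc.sub (analyticAt_const.add
    ((analyticAt_id.pow 2).mul analyticAt_const))) (isBigO_of_smul_id (by simp [hc0])
      (h.congr_left fun s => ?_)) ?_
  · rw [smul_eq_mul]; ring
  · filter_upwards [heven] with s hs
    simp [hs]
    ring

include hκ hq in
/-- Expansion of the speed for the nonlinearity `x² q(x²)`. -/
theorem IsModeCurve.speed_sub_isBigO_two (h : IsModeCurve hα κ 1 hw d 2 φ c) :
    (fun s => c s - (symb α κ 1 + s ^ 2 * (d 0 * (d 0 / 2 / (symb α κ 1 - symb α κ 2)))))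
      =O[𝓝 0] fun s : ℝ => s ^ 4 := by
  set C := d 0 / 2 / (symb α κ 1 - symb α κ 2)
  refine isBigO_speed_of_isBigO_three h.analytic_speed h.speed_zero (h.speed_even hκ hq) ?_
  -- The leading profile alone is not enough, because its square has no component along `mode w 1`.
  -- The error of the two-term profile θ enters through φφ - θθ = (φ - θ)φ + θ(φ - θ), which is
  -- O(s⁴).
  set θ : ℝ → EllOne := fun s => s • mode w 1 + (s ^ 2 * C) • mode w 2 with hθ
  have hρ : (fun s => φ s - θ s) =O[𝓝 0] fun s : ℝ => s ^ 3 := h.profile_sub_isBigO_two hκ hq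
  have hθO : θ =O[𝓝 0] fun s : ℝ => s ^ 1 :=
    (h.profile_isBigO.sub (hρ.trans (isBigO_pow_of_le (by norm_num)))).congr_left
      fun s => sub_sub_cancel _ _
  have h1 : _ =O[𝓝 0] fun s : ℝ => s ^ 4 := mulOp_isBigO hw hρ h.profile_isBigO
  have h2 : _ =O[𝓝 0] fun s : ℝ => s ^ 4 := mulOp_isBigO hw hθO hρ
  have h3 := (((d 0) • (modeCoeff w 1).comp removeMean).isBigO_comp _ (𝓝 0)).trans (h1.add h2)
  have h4 := ((modeCoeff w 1).isBigO_comp _ (𝓝 0)).trans (h.nonlin_sub_isBigO hq)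
  refine (h4.add h3).congr' ?_ EventuallyEq.rfl
  filter_upwards [h.speed_mul] with s hs
  -- Only the cross term 2 s · s² C cos κx cos 2κx contributes, and half of it falls on cos κx.
  have h5 : modeCoeff w 1 (removeMean (mulOp hw (θ s) (θ s))) = s ^ 3 * C := by
    simp only [hθ, map_add, map_smul, _root_.add_apply, _root_.smul_apply, mulOp_mode_one_one,
      mulOp_mode_one_two, mulOp_mode_two_one, mulOp_mode_two_two, removeMean_mode, smul_eq_mul,
      OfNat.ofNat_ne_zero, one_ne_zero, if_true, if_false, modeCoeff_mode hw, map_zero]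
    norm_num
    ring
  rw [hs, mulOp_sq_delta_zero]
  simp only [_root_.smul_apply, ContinuousLinearMap.comp_apply, map_sub, map_add, map_smul,
    _root_.sub_apply, smul_eq_mul, h5]
  ring

/-- This is cos³ = (cos 3· + 3 cos)/4, with d 0 = q(0). The third harmonic drives the profile and
the first one the speed. -/
theorem IsModeCurve.nonlin_three_isBigO (h : IsModeCurve hα κ 1 hw d 3 φ c)
    (hq : HasScalarSeries q d r) :
    (fun s => nonlin hw d 3 (φ s) - s ^ 3 • (d 0 • ((1 / 4 : ℝ) • mode w 3 +
      (3 / 4 : ℝ) • mode w 1))) =O[𝓝 0] fun s : ℝ => s ^ (3 + 1) := by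
  have hφ2 : _ =O[𝓝 0] fun s : ℝ => s ^ 2 := mulOp_isBigO hw h.profile_isBigO h.profile_isBigO
  have hse : (fun s : ℝ => s • mode w 1) =O[𝓝 0] fun s : ℝ => s ^ 1 := by
    simpa only [pow_one] using isBigO_pow_smul_const 1 (mode w 1)
  have h1 : _ =O[𝓝 0] fun s : ℝ => s ^ 4 := mulOp_isBigO hw h.isBigO hφ2
  have h2 : _ =O[𝓝 0] fun s : ℝ => s ^ 4 := mulOp_isBigO hw hse h.mulOp_sub_isBigO
  have h3 := (((d 0) • removeMean).isBigO_comp _ (𝓝 0)).trans (h1.add h2)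
  have h4 := h.nonlin_sub_isBigO hq
  simp only [mulOp_cube_delta_zero] at h4
  have h5 : removeMean (mulOp hw (mode w 1) (mulOp hw (mode w 1) (mode w 1))) =
      (1 / 4 : ℝ) • mode w 3 + (3 / 4 : ℝ) • mode w 1 := by
    rw [mulOp_mode_one_one]
    simp only [map_add, map_smul, mulOp_mode_one_two, mulOp_mode_one_zero, removeMean_mode,
      OfNat.ofNat_ne_zero, one_ne_zero, if_false]
    module
  refine ((h4.trans (isBigO_pow_of_le (by norm_num))).add h3).congr_left fun s => ?_
  rw [← h5]
  simp only [_root_.smul_apply, map_sub, map_add, map_smul, _root_.sub_apply]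
  module

include hκ hq in
/-- Expansion of the profile for the nonlinearity `x³ q(x²)`. -/
theorem IsModeCurve.profile_sub_isBigO_three (h : IsModeCurve hα κ 1 hw d 3 φ c) :
    (fun s => φ s - (s • mode w 1 +
      (s ^ 3 * (d 0 / 4 / (symb α κ 1 - symb α κ 3))) • mode w 3)) =O[𝓝 0]
        fun s : ℝ => s ^ 5 := by
  obtain ⟨D, hD⟩ := exists_linearization hα hκ one_ne_zero hw
  have hne : symb α κ 1 - symb α κ 3 ≠ 0 :=
    sub_ne_zero.2 (symb_ne hα hκ three_ne_zero (by norm_num))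
  have := bifurcation_curve_isBigO (fracOp hα κ)
    (modeCoeff w 1) (mode w 1) (symb α κ 1) (modeCoeff_mode_self hw) (fracOp_mode hα κ w 1) D hD
    (nonlin hw d 3) φ c h.coeff h.solves 3
    (-(d 0 / 4 / (symb α κ 1 - symb α κ 3)) • mode w 3)
    (d 0 • ((1 / 4 : ℝ) • mode w 3 + (3 / 4 : ℝ) • mode w 1))
    (by rw [map_smul, modeCoeff_mode hw]; simp)
    (by
      rw [map_smul, hD, fracOp_mode]
      simp only [map_smul, map_add, modeCoeff_mode hw, if_neg (show (1 : ℕ) ≠ 3 by norm_num),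
        if_true, zero_smul, sub_zero, smul_eq_mul, mul_zero, zero_add, mul_one, ← sub_smul,
        smul_smul, smul_add, add_sub_cancel_right]
      congr 1
      field_simp
      ring) (h.nonlin_three_isBigO hq)
    (((h.speed_isBigO hκ hq).smul h.isBigO).congr_right fun s => (pow_add s 2 2).symm)
  -- The general estimate stops at O(s⁴). The profile and its approximation are both odd in s, which
  -- gives one more power.
  refine isBigO_pow_succ_of_parity 4 (h.analytic_profile.sub
    ((analyticAt_id.smul analyticAt_const).add
      (((analyticAt_id.pow 3).mul analyticAt_const).smul analyticAt_const)))
    (this.congr_left fun s => ?_) ?_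
  · module
  · filter_upwards [h.profile_odd (by decide)] with s hs
    rw [hs]
    module

include hκ hq in
/-- Expansion of the speed for the nonlinearity `x³ q(x²)`. -/
theorem IsModeCurve.speed_sub_isBigO_three (h : IsModeCurve hα κ 1 hw d 3 φ c) :
    (fun s => c s - (symb α κ 1 + s ^ 2 * (3 / 4 * d 0))) =O[𝓝 0] fun s : ℝ => s ^ 4 := by
  refine isBigO_speed_of_isBigO_three h.analytic_speed h.speed_zero (h.speed_even hκ hq) ?_
  have h1 := ((modeCoeff w 1).isBigO_comp _ (𝓝 0)).trans (h.nonlin_three_isBigO hq)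
  refine h1.congr' ?_ EventuallyEq.rfl
  filter_upwards [h.speed_mul] with s hs
  rw [hs]
  simp only [map_sub, map_add, map_smul, modeCoeff_mode hw, smul_eq_mul,
    if_neg (show (1 : ℕ) ≠ 3 by norm_num), if_true]
  ring

end

end NegDispersive

/-! ### Passage between Hölder functions and sequences. -/

namespace NegDispersive

open EllOne

theorem EvenHolder.even {β : ℝ≥0} (f : EvenHolder β) (x : Torus) : f (-x) = f x := f.2.2.1 x

theorem EvenHolder.integral_eq_zero {β : ℝ≥0} (f : EvenHolder β) : ∫ x, f x = 0 := f.2.2.2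

section Coefficients

/-- The function `cos (m x)` as a sum of exponentials. -/
theorem fourier_add_fourier_neg (m : ℕ) (x : Torus) :
    fourier (T := 2 * π) (m : ℤ) x + fourier (-(m : ℤ)) x = ((2 * cosT m x : ℝ) : ℂ) := by
  rw [fourier_neg, Complex.add_conj, cosT_apply]

theorem fourierCoeff_even {f : C(Torus, ℝ)} (hf : ∀ x, f (-x) = f x) (m : ℤ) :
    fourierCoeff (fun x => (f x : ℂ)) m =
      (((2 * π)⁻¹ * ∫ x, f x * cosT m.natAbs x : ℝ) : ℂ) := by
  have hc : ∀ n : ℤ, Integrable (fun x : Torus => fourier (T := 2 * π) n x • (f x : ℂ)) :=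
    fun n => Continuous.integrable_of_hasCompactSupport
      ((fourier n).continuous.smul (Complex.continuous_ofReal.comp f.continuous))
      (HasCompactSupport.of_compactSpace _)
  have h1 : ∫ x : Torus, fourier (T := 2 * π) (-m) x • (f x : ℂ) =
      ∫ x : Torus, fourier (T := 2 * π) m x • (f x : ℂ) := by
    rw [← integral_neg_eq_self]
    refine integral_congr_ae (Eventually.of_forall fun x => ?_)
    simp only [hf]
    congr 1
    simp only [fourier_apply, smul_neg, neg_smul, neg_neg]
  have h2 : ∀ x : Torus, fourier (T := 2 * π) m x • (f x : ℂ) +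
      fourier (T := 2 * π) (-m) x • (f x : ℂ) = ((2 * (f x * cosT m.natAbs x) : ℝ) : ℂ) := by
    intro x
    rw [← add_smul]
    have : fourier (T := 2 * π) m x + fourier (-m) x = ((2 * cosT m.natAbs x : ℝ) : ℂ) := by
      rcases Int.natAbs_eq m with h | h
      · rw [← fourier_add_fourier_neg, ← h]
      · rw [← fourier_add_fourier_neg, add_comm]
        nth_rewrite 1 [h]
        nth_rewrite 2 [h]
        rw [neg_neg]
    rw [this]
    push_cast
    rw [smul_eq_mul]; ring
  have h3 : 2 * ∫ x : Torus, fourier (T := 2 * π) (-m) x • (f x : ℂ) =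
      ((2 * ∫ x, f x * cosT m.natAbs x : ℝ) : ℂ) := by
    rw [two_mul]
    nth_rewrite 1 [h1]
    rw [← integral_add (hc _) (hc _), integral_congr_ae (Eventually.of_forall h2),
      ← integral_const_mul]
    exact integral_ofReal (𝕜 := ℂ)
  rw [fourierCoeff, AddCircle.integral_haarAddCircle]
  have h4 : ∫ x : Torus, fourier (T := 2 * π) (-m) x • (f x : ℂ) =
      ((∫ x, f x * cosT m.natAbs x : ℝ) : ℂ) := by
    have : (2 : ℂ) ≠ 0 := two_ne_zero
    apply mul_left_cancel₀ this
    rw [h3]; push_cast; ring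
  rw [h4, Complex.real_smul]
  push_cast
  ring

end Coefficients

/-! ### Bernstein's theorem on absolute convergence. -/

section Bernstein

theorem fourierCoeff_translate_sub (g : C(Torus, ℂ)) (h : Torus) (m : ℤ) :
    fourierCoeff (fun x => g (x + h) - g x) m = (fourier m h - 1) * fourierCoeff g m := by
  have hc : ∀ t : Torus, Integrable (fun x : Torus => fourier (T := 2 * π) (-m) x • g (x + t))
      AddCircle.haarAddCircle :=
    fun t => Continuous.integrable_of_hasCompactSupport
      ((fourier (-m)).continuous.smul (g.continuous.comp (continuous_add_const t)))
      (HasCompactSupport.of_compactSpace _)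
  have h0 := hc 0
  simp only [add_zero] at h0
  have h1 : ∫ x : Torus, fourier (T := 2 * π) (-m) x • g (x + h) ∂AddCircle.haarAddCircle =
      fourier m h * ∫ x : Torus, fourier (T := 2 * π) (-m) x • g x ∂AddCircle.haarAddCircle := by
    rw [← integral_const_mul, ← integral_add_right_eq_self
      (fun x : Torus => fourier (T := 2 * π) m h * fourier (T := 2 * π) (-m) x • g x) h]
    refine integral_congr_ae (Eventually.of_forall fun x => ?_)
    have e1 : fourier (T := 2 * π) (-m) (x + h) = fourier (-m) x * fourier (-m) h := by
      simp only [fourier_apply, smul_add, AddCircle.toCircle_add, Circle.coe_mul]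
    have e2 : fourier (T := 2 * π) m h * fourier (-m) h = 1 := by
      rw [← fourier_add, add_neg_cancel, fourier_zero]
    simp only [e1, smul_eq_mul]
    linear_combination (- fourier (T := 2 * π) (-m) x * g (x + h)) * e2
  unfold fourierCoeff
  simp only [smul_sub]
  rw [integral_sub (hc h) h0, h1]
  ring

/-- Parseval for the difference of a function and a translate. -/
theorem sum_sq_fourierCoeff_le (g : C(Torus, ℂ)) (h : Torus) {B : ℝ}
    (hB : ∀ x, ‖g (x + h) - g x‖ ≤ B) (S : Finset ℤ) :
    ∑ m ∈ S, ‖(fourier m h - 1) * fourierCoeff g m‖ ^ 2 ≤ B ^ 2 := by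
  set G : C(Torus, ℂ) := ⟨fun x => g (x + h) - g x,
    (g.continuous.comp (continuous_add_const h)).sub g.continuous⟩ with hG
  have h1 := hasSum_sq_fourierCoeff
    (ContinuousMap.toLp (E := ℂ) 2 (AddCircle.haarAddCircle (T := 2 * π)) ℂ G)
  have h2 : ∀ m, fourierCoeff (ContinuousMap.toLp (E := ℂ) 2
      (AddCircle.haarAddCircle (T := 2 * π)) ℂ G) m = (fourier m h - 1) * fourierCoeff g m :=
    fun m => (fourierCoeff_toLp G m).trans (fourierCoeff_translate_sub g h m)
  simp only [h2] at h1
  refine (sum_le_hasSum S (fun _ _ => by positivity) h1).trans ?_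
  have h3 : ∫ t, ‖(ContinuousMap.toLp (E := ℂ) 2
      (AddCircle.haarAddCircle (T := 2 * π)) ℂ G) t‖ ^ 2 ∂AddCircle.haarAddCircle =
      ∫ t, ‖G t‖ ^ 2 ∂AddCircle.haarAddCircle := by
    refine integral_congr_ae ?_
    filter_upwards [ContinuousMap.coeFn_toLp (p := 2) (𝕜 := ℂ)
      (AddCircle.haarAddCircle (T := 2 * π)) G] with t ht
    rw [ht]
  rw [h3]
  have h4 : ∫ t, ‖G t‖ ^ 2 ∂(AddCircle.haarAddCircle (T := 2 * π)) ≤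
      ∫ _t, B ^ 2 ∂(AddCircle.haarAddCircle (T := 2 * π)) := by
    refine integral_mono ?_ (integrable_const _) fun t => ?_
    · exact Continuous.integrable_of_hasCompactSupport (by fun_prop)
        (HasCompactSupport.of_compactSpace _)
    · exact pow_le_pow_left₀ (norm_nonneg _) (hB t) 2
  simpa using h4

theorem norm_fourier_sub_one_sq (m : ℤ) (h : ℝ) :
    ‖fourier (T := 2 * π) m (h : Torus) - 1‖ ^ 2 = 2 - 2 * Real.cos (m * h) := by
  have h1 : fourier (T := 2 * π) m (h : Torus) = Complex.exp ((m * h : ℝ) * Complex.I) := by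
    rw [fourier_coe_apply]
    congr 1
    push_cast
    have : (π : ℂ) ≠ 0 := by exact_mod_cast Real.pi_ne_zero
    field_simp
  rw [h1, Complex.sq_norm, Complex.normSq_apply, Complex.sub_re, Complex.sub_im,
    Complex.exp_ofReal_mul_I_re, Complex.exp_ofReal_mul_I_im, Complex.one_re, Complex.one_im]
  linear_combination Real.sin_sq_add_cos_sq (m * h)

theorem dist_translate_le (f : C(Torus, ℝ)) {β : ℝ≥0} (hf : MemHolder β f) (x : Torus) {h : ℝ}
    (hh : 0 ≤ h) (hhπ : h ≤ π) :
    |f (x + (h : Torus)) - f x| ≤ nnHolderNorm β f * h ^ (β : ℝ) := by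
  rw [← Real.dist_eq]
  refine hf.holderWith.dist_le_of_le ?_
  have h1 : ‖(h : Torus)‖ = |h| := by
    rw [AddCircle.norm_coe_eq_abs_iff _ Real.two_pi_pos.ne', abs_of_nonneg hh,
      abs_of_pos Real.two_pi_pos]
    linarith
  rw [dist_eq_norm, add_sub_cancel_left, h1, abs_of_nonneg hh]

/-- The cosine coefficients on a dyadic block. -/
theorem sum_dyadic_le (f : C(Torus, ℝ)) (heven : ∀ x, f (-x) = f x) {β : ℝ≥0}
    (hf : MemHolder β f) (j : ℕ) :
    ∑ m ∈ Finset.Ico (2 ^ j) (2 ^ (j + 1)), |π⁻¹ * ∫ x, f x * cosT m x| ≤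
      2 * π ^ (β : ℝ) * nnHolderNorm β f * ((2 : ℝ) ^ (1 / 2 - (β : ℝ))) ^ j := by
  set H : ℝ := (nnHolderNorm β f : ℝ) with hH
  have hH0 : 0 ≤ H := NNReal.coe_nonneg _
  -- With this shift mh lies in [π/2, π] for every m in the block, so |exp(imh) - 1|² = 2 - 2
  -- cos(mh) ≥ 2. Since the Fourier coefficient is a m / 2, Parseval for the difference then bounds
  -- ∑ (a m)²/2.
  set h : ℝ := π / 2 ^ (j + 1) with hh
  have hπ := Real.pi_pos
  have hh0 : 0 < h := by positivity
  have hhπ : h ≤ π := div_le_self hπ.le (one_le_pow₀ one_le_two)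
  set g : C(Torus, ℂ) := ⟨fun x => (f x : ℂ), Complex.continuous_ofReal.comp f.continuous⟩ with hg
  have hB : ∀ x, ‖g (x + (h : Torus)) - g x‖ ≤ H * h ^ (β : ℝ) := by
    intro x
    change ‖((f (x + (h : Torus)) : ℝ) : ℂ) - ((f x : ℝ) : ℂ)‖ ≤ _
    rw [← Complex.ofReal_sub, Complex.norm_real]
    exact dist_translate_le f hf x hh0.le hhπ
  set a : ℕ → ℝ := fun m => π⁻¹ * ∫ x, f x * cosT m x with ha
  have hco : ∀ m : ℕ, fourierCoeff g (m : ℤ) = ((a m / 2 : ℝ) : ℂ) := by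
    intro m
    have := fourierCoeff_even heven (m : ℤ)
    rw [Int.natAbs_natCast] at this
    refine this.trans ?_
    congr 1
    simp only [ha, mul_inv]
    ring
  have h1 := sum_sq_fourierCoeff_le g (h : Torus) hB
    ((Finset.Ico (2 ^ j) (2 ^ (j + 1))).map Nat.castEmbedding)
  rw [Finset.sum_map] at h1
  have h2 : ∑ m ∈ Finset.Ico (2 ^ j) (2 ^ (j + 1)), a m ^ 2 / 2 ≤ (H * h ^ (β : ℝ)) ^ 2 := by
    refine (Finset.sum_le_sum fun m hm => ?_).trans h1
    rw [Finset.mem_Ico] at hm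
    have e0 : (Nat.castEmbedding m : ℤ) = (m : ℤ) := rfl
    rw [e0, norm_mul, mul_pow ‖fourier (m : ℤ) (h : Torus) - 1‖, norm_fourier_sub_one_sq, hco, Complex.norm_real, Real.norm_eq_abs,
      sq_abs]
    have e1 : (2 : ℝ) ^ j ≤ m := by exact_mod_cast hm.1
    have e2 : (m : ℝ) ≤ 2 ^ (j + 1) := by exact_mod_cast hm.2.le
    have e3 : π / 2 ≤ m * h := by
      calc π / 2 = 2 ^ j * h := by rw [hh, pow_succ]; field_simp
        _ ≤ m * h := by gcongr
    have e4 : m * h ≤ π := by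
      calc m * h ≤ 2 ^ (j + 1) * h := by gcongr
        _ = π := by rw [hh]; field_simp
    have e5 : Real.cos (m * h) ≤ 0 := Real.cos_nonpos_of_pi_div_two_le_of_le e3 (by linarith)
    have e6 : ((m : ℤ) : ℝ) = (m : ℝ) := Int.cast_natCast m
    rw [e6]
    nlinarith [sq_nonneg (a m)]
  -- Cauchy-Schwarz on the 2^j indices of the block costs 2^(j/2), against the gain 2^(-jβ).
  have h3 := sq_sum_le_card_mul_sum_sq (s := Finset.Ico (2 ^ j) (2 ^ (j + 1)))
    (f := fun m => |a m|)
  simp only [sq_abs, Nat.card_Ico] at h3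
  have h4 : ((2 ^ (j + 1) - 2 ^ j : ℕ) : ℝ) = 2 ^ j := by
    rw [Nat.cast_sub (Nat.pow_le_pow_right two_pos (Nat.le_add_right j 1))]; push_cast; ring
  rw [h4] at h3
  rw [← Finset.sum_div] at h2
  have hρ : ((2 : ℝ) ^ (1 / 2 - (β : ℝ))) ^ j = (2 : ℝ) ^ ((j : ℝ) / 2) * ((2 : ℝ) ^ j)⁻¹ ^ (β : ℝ) := by
    rw [← Real.rpow_natCast, ← Real.rpow_mul two_pos.le, Real.inv_rpow (by positivity),
      ← Real.rpow_natCast, ← Real.rpow_mul two_pos.le, ← Real.rpow_neg two_pos.le,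
      ← Real.rpow_add two_pos]
    congr 1
    ring
  have h5 : ((2 : ℝ) ^ ((j : ℝ) / 2)) ^ 2 = 2 ^ j := by
    rw [← Real.rpow_natCast, ← Real.rpow_mul two_pos.le, ← Real.rpow_natCast]
    congr 1
    push_cast
    ring
  have h6 : h ^ (β : ℝ) ≤ π ^ (β : ℝ) * ((2 : ℝ) ^ j)⁻¹ ^ (β : ℝ) := by
    rw [← Real.mul_rpow hπ.le (by positivity)]
    refine Real.rpow_le_rpow hh0.le ?_ β.coe_nonneg
    rw [hh, div_eq_mul_inv]
    gcongr
    · norm_num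
    · omega
  set T := ((2 : ℝ) ^ j)⁻¹ ^ (β : ℝ) with hT
  have hT0 : 0 ≤ T := by positivity
  have h7 : (H * h ^ (β : ℝ)) ^ 2 ≤ (H * (π ^ (β : ℝ) * T)) ^ 2 := by
    have : 0 ≤ h ^ (β : ℝ) := by positivity
    gcongr
  rw [hρ]
  refine le_of_sq_le_sq ?_ (by positivity)
  refine h3.trans ?_
  calc (2 : ℝ) ^ j * ∑ m ∈ Finset.Ico (2 ^ j) (2 ^ (j + 1)), a m ^ 2
      ≤ 2 ^ j * (4 * (H * (π ^ (β : ℝ) * T)) ^ 2) := by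
        gcongr
        nlinarith [sq_nonneg (H * (π ^ (β : ℝ) * T))]
    _ = (2 * π ^ (β : ℝ) * H * (2 ^ ((j : ℝ) / 2) * T)) ^ 2 := by
        rw [← h5]; ring

theorem sum_range_two_pow_eq (F : ℕ → ℝ) (J : ℕ) :
    ∑ m ∈ Finset.range (2 ^ J), F m = F 0 + ∑ j ∈ Finset.range J,
      ∑ m ∈ Finset.Ico (2 ^ j) (2 ^ (j + 1)), F m := by
  induction J with
  | zero => simp
  | succ J ih =>
    rw [Finset.sum_range_succ, ← add_assoc, ← ih,
      Finset.sum_range_add_sum_Ico _ (Nat.pow_le_pow_right two_pos (Nat.le_add_right J 1))]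

/-- Bernstein's theorem: for `β > 1/2` the Fourier coefficients are absolutely summable. -/
theorem exists_sum_abs_coeff_le {β : ℝ≥0} (hβ : 1 / 2 < (β : ℝ)) : ∃ K : ℝ, 0 ≤ K ∧
    ∀ f : EvenHolder β, ∀ s : Finset ℕ, ∑ m ∈ s, |π⁻¹ * ∫ x, f x * cosT m x| ≤ K * ‖f‖ := by
  -- The dyadic blocks decay like a geometric series of ratio ρ, which is below 1 exactly when β >
  -- 1/2.
  set ρ : ℝ := (2 : ℝ) ^ (1 / 2 - (β : ℝ)) with hρ
  have hρ0 : 0 ≤ ρ := by positivity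
  have hρ1 : ρ < 1 := Real.rpow_lt_one_of_one_lt_of_neg one_lt_two (by linarith)
  refine ⟨2 * π ^ (β : ℝ) * (1 - ρ)⁻¹, by
    have := inv_nonneg.2 (sub_pos.2 hρ1).le
    positivity, fun f s => ?_⟩
  obtain ⟨J, hJ⟩ : ∃ J, s ⊆ Finset.range (2 ^ J) := by
    obtain ⟨N, hN⟩ := s.exists_nat_subset_range
    exact ⟨N, hN.trans (Finset.range_subset_range.2 Nat.lt_two_pow_self.le)⟩
  refine (Finset.sum_le_sum_of_subset_of_nonneg hJ fun _ _ _ => abs_nonneg _).trans ?_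
  rw [sum_range_two_pow_eq]
  -- Frequency 0 lies in no dyadic block; it is handled by the zero mean.
  have h0 : ∫ x, f x * cosT 0 x = 0 := by
    simp only [cosT_zero, mul_one]
    exact f.integral_eq_zero
  rw [h0, mul_zero, abs_zero, zero_add]
  have hH : (nnHolderNorm β f : ℝ) ≤ ‖f‖ := by
    rw [EvenHolder.norm_def]
    exact le_add_of_nonneg_left (norm_nonneg _)
  have h1 : ∑ j ∈ Finset.range J, ρ ^ j ≤ (1 - ρ)⁻¹ := by
    rw [← tsum_geometric_of_lt_one hρ0 hρ1]
    exact (summable_geometric_of_lt_one hρ0 hρ1).sum_le_tsum _ fun _ _ => by positivity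
  calc ∑ j ∈ Finset.range J, ∑ m ∈ Finset.Ico (2 ^ j) (2 ^ (j + 1)), |π⁻¹ * ∫ x, f x * cosT m x|
      ≤ ∑ j ∈ Finset.range J, 2 * π ^ (β : ℝ) * nnHolderNorm β f * ρ ^ j :=
        Finset.sum_le_sum fun j _ => sum_dyadic_le f.toCont f.even f.memHolder j
    _ = 2 * π ^ (β : ℝ) * nnHolderNorm β f * ∑ j ∈ Finset.range J, ρ ^ j := by
        rw [Finset.mul_sum]
    _ ≤ 2 * π ^ (β : ℝ) * ‖f‖ * (1 - ρ)⁻¹ := by gcongr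
    _ = _ := by ring

/-- The sequence of cosine coefficients of an even Hölder function. -/
noncomputable def coeffSeq {β : ℝ≥0} (hβ : 1 / 2 < (β : ℝ)) (f : EvenHolder β) : EllOne :=
  ⟨fun m => π⁻¹ * ∫ x, f x * cosT m x, memℓp_gen' (C := (exists_sum_abs_coeff_le hβ).choose * ‖f‖)
    fun s => by
      simpa using (exists_sum_abs_coeff_le hβ).choose_spec.2 f s⟩

theorem coeffSeq_apply {β : ℝ≥0} (hβ : 1 / 2 < (β : ℝ)) (f : EvenHolder β) (m : ℕ) :
    coeffSeq hβ f m = π⁻¹ * ∫ x, f x * cosT m x := rfl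

theorem norm_coeffSeq_le {β : ℝ≥0} (hβ : 1 / 2 < (β : ℝ)) (f : EvenHolder β) :
    ‖coeffSeq hβ f‖ ≤ (exists_sum_abs_coeff_le hβ).choose * ‖f‖ := by
  have h := (exists_sum_abs_coeff_le hβ).choose_spec
  exact (hasSum_norm _).tsum_eq.symm.trans_le
    ((hasSum_norm _).summable.tsum_le_of_sum_le fun s => h.2 f s)

theorem tendsto_coeffSeq {β : ℝ≥0} (hβ : 1 / 2 < (β : ℝ)) :
    Tendsto (coeffSeq hβ) (𝓝 0) (𝓝 0) := by
  refine squeeze_zero_norm (norm_coeffSeq_le hβ) ?_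
  exact Continuous.tendsto' (by fun_prop) _ _ (by simp)

end Bernstein

/-! ### Hölder functions as sums of their cosine series. -/

section Synthesis

/-- A cosine series as a Fourier series over the integers. -/
theorem hasSum_fourier_of_ellOne (b : EllOne) (hb : b 0 = 0) (x : Torus) :
    HasSum (fun m : ℤ => ((b m.natAbs / 2 : ℝ) : ℂ) * fourier (T := 2 * π) m x)
      ((ev 1 isWeight_one x b : ℝ) : ℂ) := by
  set F : ℤ → ℂ := fun m => ((b m.natAbs / 2 : ℝ) : ℂ) * fourier (T := 2 * π) m x with hF
  have hn : ∀ m, ‖F m‖ = |b m.natAbs| / 2 := fun m => by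
    rw [hF]
    simp only [norm_mul, Complex.norm_real, Real.norm_eq_abs, abs_div, fourier_apply,
      Circle.norm_coe, mul_one, abs_two]
  have hs : Summable F := by
    have h1 := (hasSum_norm b).summable.div_const 2
    refine Summable.of_nat_of_neg (Summable.of_norm ?_) (Summable.of_norm ?_)
    · exact h1.congr fun m => by rw [hn, Int.natAbs_natCast]
    · exact h1.congr fun m => by rw [hn, Int.natAbs_neg, Int.natAbs_natCast]
  have h2 := hs.hasSum.nat_add_neg
  have h3 : F 0 = 0 := by simp [hF, hb]
  rw [h3, add_zero] at h2
  have h4 : HasSum (fun n : ℕ => F n + F (-n)) ((ev 1 isWeight_one x b : ℝ) : ℂ) := by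
    have h5 := Complex.hasSum_ofReal.2 (hasSum_ev isWeight_one 1 x b)
    refine h5.congr_fun fun n => ?_
    simp only [hF, Int.natAbs_neg, Int.natAbs_natCast, ← mul_add, fourier_add_fourier_neg]
    push_cast
    simp
    ring
  rw [← h2.unique h4]
  exact hs.hasSum

variable {β : ℝ≥0} (hβ : 1 / 2 < (β : ℝ)) (f : EvenHolder β)

theorem coeffSeq_zero : coeffSeq hβ f 0 = 0 := by
  rw [coeffSeq_apply]
  simp only [cosT_zero, mul_one]
  rw [f.integral_eq_zero, mul_zero]

theorem fourierCoeff_evenHolder (m : ℤ) :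
    fourierCoeff (fun x => (f x : ℂ)) m = ((coeffSeq hβ f m.natAbs / 2 : ℝ) : ℂ) := by
  rw [fourierCoeff_even f.even, coeffSeq_apply]
  congr 1
  rw [mul_inv]
  ring

/-- By Bernstein's theorem the Fourier coefficients are summable, so the series converges to f at
every point. -/
theorem ev_coeffSeq (x : Torus) : ev 1 isWeight_one x (coeffSeq hβ f) = f x := by
  set g : C(Torus, ℂ) := ⟨fun x => (f x : ℂ), Complex.continuous_ofReal.comp f.toCont.continuous⟩
  have hc : ∀ m, fourierCoeff g m = ((coeffSeq hβ f m.natAbs / 2 : ℝ) : ℂ) :=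
    fourierCoeff_evenHolder hβ f
  have hs : Summable (fourierCoeff g) := by
    have h1 := (hasSum_norm (coeffSeq hβ f)).summable.div_const 2
    refine Summable.of_nat_of_neg (Summable.of_norm ?_) (Summable.of_norm ?_) <;>
    · refine h1.congr fun m => ?_
      rw [hc, Complex.norm_real, Real.norm_eq_abs, abs_div, abs_two]
      simp
  have h1 := has_pointwise_sum_fourier_series_of_summable hs x
  have h2 := hasSum_fourier_of_ellOne (coeffSeq hβ f) (coeffSeq_zero hβ f) x
  simp only [hc, smul_eq_mul] at h1
  exact Complex.ofReal_injective (h2.unique h1)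

theorem fracInt_eq_ev {α : ℝ} (hα : 0 < α) (x : Torus) :
    fracInt α f x = ev 1 isWeight_one x (fracOp hα 1 (coeffSeq hβ f)) := by
  have h0 : fracOp hα 1 (coeffSeq hβ f) 0 = 0 := by rw [fracOp_apply, coeffSeq_zero, mul_zero]
  have h1 := hasSum_fourier_of_ellOne _ h0 x
  rw [fracInt, ← Complex.ofReal_re (ev 1 isWeight_one x (fracOp hα 1 (coeffSeq hβ f))),
    ← h1.tsum_eq]
  congr 2
  ext m
  split_ifs with hm
  · rw [hm, Int.natAbs_zero, h0]; simp
  · rw [fourierCoeff_evenHolder hβ, fracOp_apply, symb, one_mul, Nat.cast_natAbs, Int.cast_abs]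
    push_cast
    ring

end Synthesis

/-! ### Weighted cosine series as Hölder functions. -/

section Embedding

theorem abs_cosT_sub_le (m : ℕ) (x y : Torus) : |cosT m x - cosT m y| ≤ m * dist x y := by
  rcases Nat.eq_zero_or_pos m with rfl | hm
  · simp [cosT_zero]
  · have := (cosFun_lipschitz ⟨m, hm⟩).dist_le_mul x y
    rw [Real.dist_eq] at this
    have e : ∀ z, cosT m z = cosFun ⟨m, hm⟩ z := cosT_eq_cosFun ⟨m, hm⟩
    rw [e, e]
    simpa using this

/-- The weight cancels the growth of the derivative: each term has Lipschitz constant at most κ |a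
m| m / (m + 1) ≤ κ |a m|. -/
theorem abs_ev_sub_le (κ : ℕ) (a : EllOne) (x y : Torus) :
    |ev κ isWeight_succ x a - ev κ isWeight_succ y a| ≤ κ * ‖a‖ * dist x y := by
  have h1 := (hasSum_ev isWeight_succ κ x a).sub (hasSum_ev isWeight_succ κ y a)
  have h2 : HasSum (fun m => κ * |a m| * dist x y) (κ * ‖a‖ * dist x y) :=
    ((hasSum_norm a).mul_left _).mul_right _
  rw [← h1.tsum_eq, ← Real.norm_eq_abs]
  refine tsum_of_norm_bounded h2 fun m => ?_
  have hm : (0 : ℝ) < (m : ℝ) + 1 := by positivity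
  have h3 := abs_cosT_sub_le (κ * m) x y
  rw [← mul_sub, ← mul_sub, Real.norm_eq_abs, abs_mul, abs_mul, abs_of_pos (inv_pos.2 hm)]
  have h4 : ((m : ℝ) + 1)⁻¹ * |cosT (κ * m) x - cosT (κ * m) y| ≤ κ * dist x y := by
    rw [inv_mul_le_iff₀ hm]
    refine h3.trans ?_
    push_cast
    have : 0 ≤ (κ : ℝ) * dist x y := by positivity
    nlinarith
  calc |a m| * (((m : ℝ) + 1)⁻¹ * |cosT (κ * m) x - cosT (κ * m) y|)
      ≤ |a m| * (κ * dist x y) := by gcongr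
    _ = κ * |a m| * dist x y := by ring

/-- A Lipschitz function on a space of diameter at most π is Hölder, at the cost of the factor π^(1
- β). -/
theorem holderWith_synth (κ : ℕ) {β : ℝ≥0} (hβ1 : β ≤ 1) (a : EllOne) :
    HolderWith (κ * ‖a‖₊ * (NNReal.pi ^ ((1 : ℝ≥0) - β : ℝ))) β (synth isWeight_succ κ a) := by
  have h1 : LipschitzWith (κ * ‖a‖₊) (synth isWeight_succ κ a) :=
    LipschitzWith.of_dist_le_mul fun x y => by
      rw [Real.dist_eq, synth_apply, synth_apply]
      exact abs_ev_sub_le κ a x y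
  refine (holderWith_one.2 h1).of_le (fun x y => ?_) hβ1
  rw [edist_nndist, ENNReal.coe_le_coe, ← NNReal.coe_le_coe, coe_nndist, dist_eq_norm]
  refine (AddCircle.norm_le_half_period (2 * π) Real.two_pi_pos.ne').trans ?_
  rw [abs_of_pos Real.two_pi_pos]
  exact (mul_div_cancel_left₀ _ two_ne_zero).le

theorem norm_removeMean_le (a : EllOne) : ‖removeMean a‖ ≤ ‖a‖ := by
  refine (norm_lift_apply_le _ 1 (fun m => ?_) a).trans (one_mul _).le
  rw [norm_smul, norm_delta]
  dsimp only
  split_ifs <;> simp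

theorem norm_synth_le (κ : ℕ) (a : EllOne) : ‖synth isWeight_succ κ a‖ ≤ ‖a‖ :=
  (ContinuousMap.norm_le _ (norm_nonneg _)).2 fun x => by
    rw [synth_apply]; exact abs_ev_le isWeight_succ κ x a

theorem ev_neg {w : ℕ → ℝ} (hw : IsWeight w) (κ : ℕ) (x : Torus) (a : EllOne) :
    ev κ hw (-x) a = ev κ hw x a := by
  have : ev κ hw (-x) = ev κ hw x := clm_ext fun m => by rw [ev_delta, ev_delta, cosT_neg]
  rw [this]

variable {κ : ℕ} (hκ : κ ≠ 0) {β : ℝ≥0} (hβ1 : β ≤ 1)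

/-- The cosine series with the coefficients `a m / (m + 1)`, `m ≥ 1`, as a Hölder function. -/
noncomputable def embedLinear : EllOne →ₗ[ℝ] EvenHolder β where
  toFun a := (⟨synth isWeight_succ κ (removeMean a), (holderWith_synth κ hβ1 _).memHolder,
    fun x => by rw [synth_apply, synth_apply, ev_neg], by
      simp only [synth_apply]
      rw [integral_ev isWeight_succ hκ, removeMean_apply, if_pos rfl, zero_mul]⟩ :
        ↥(evenHolderSubmodule β))
  map_add' a b := EvenHolder.toCont_injective (by
    change synth isWeight_succ κ (removeMean (a + b)) =
      synth isWeight_succ κ (removeMean a) + synth isWeight_succ κ (removeMean b)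
    rw [map_add, map_add])
  map_smul' r a := EvenHolder.toCont_injective (by
    change synth isWeight_succ κ (removeMean (r • a)) = r • synth isWeight_succ κ (removeMean a)
    rw [map_smul, map_smul])

theorem norm_embedLinear_le (a : EllOne) :
    ‖embedLinear hκ hβ1 a‖ ≤ (1 + κ * (NNReal.pi ^ ((1 : ℝ≥0) - β : ℝ) : ℝ≥0)) * ‖a‖ := by
  rw [EvenHolder.norm_def]
  have h1 : ‖(embedLinear hκ hβ1 a).toCont‖ ≤ ‖a‖ :=
    (norm_synth_le κ (removeMean a)).trans (norm_removeMean_le a)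
  have h2 : nnHolderNorm β (embedLinear hκ hβ1 a) ≤
      κ * ‖removeMean a‖₊ * (NNReal.pi ^ ((1 : ℝ≥0) - β : ℝ)) :=
    (holderWith_synth κ hβ1 (removeMean a)).nnholderNorm_le
  have h3 : (nnHolderNorm β (embedLinear hκ hβ1 a) : ℝ) ≤
      κ * ‖removeMean a‖ * (NNReal.pi ^ ((1 : ℝ≥0) - β : ℝ) : ℝ≥0) := by exact_mod_cast h2
  have h4 : κ * ‖removeMean a‖ * (NNReal.pi ^ ((1 : ℝ≥0) - β : ℝ) : ℝ≥0) ≤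
      κ * ‖a‖ * (NNReal.pi ^ ((1 : ℝ≥0) - β : ℝ) : ℝ≥0) := by
    gcongr
    exact norm_removeMean_le a
  linarith

/-- The embedding of the weighted cosine series without mean into the Hölder space. -/
noncomputable def embed : EllOne →L[ℝ] EvenHolder β :=
  (embedLinear hκ hβ1).mkContinuous _ (norm_embedLinear_le hκ hβ1)

theorem embed_apply (a : EllOne) (x : Torus) :
    embed hκ hβ1 a x = ev κ isWeight_succ x (removeMean a) := synth_apply isWeight_succ κ _ x

theorem embed_mode {m : ℕ} (n : ℕ+) (hn : (n : ℕ) = κ * m) :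
    embed hκ hβ1 (mode (fun m => (m : ℝ) + 1) m) = cosMode hβ1 n := by
  have hm : m ≠ 0 := by rintro rfl; exact n.ne_zero hn
  refine EvenHolder.toCont_injective (ContinuousMap.ext fun x => ?_)
  rw [embed_apply, removeMean_mode, if_neg hm, ev_mode, ← hn, cosT_eq_cosFun]
  rfl

end Embedding

end NegDispersive

/-! ### Comparison of the two sequence spaces, and the curve in X^β. -/

namespace NegDispersive

open EllOne

section Reindex

theorem norm_inv_smul_delta_le (m n : ℕ) : ‖((m : ℝ) + 1)⁻¹ • delta n‖ ≤ 1 := by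
  rw [norm_smul, norm_delta, mul_one, norm_inv, Real.norm_of_nonneg (by positivity)]
  exact inv_le_one_of_one_le₀ (by simp)

/-- The unweighted coefficients in terms of `cos (m x)` of a weighted series in `cos (k m x)`. -/
noncomputable def reindex (k : ℕ) : EllOne →L[ℝ] EllOne :=
  lift (fun m => ((m : ℝ) + 1)⁻¹ • delta (k * m)) 1 fun m => norm_inv_smul_delta_le m (k * m)

theorem reindex_delta (k m : ℕ) :
    reindex k (delta m) = ((m : ℝ) + 1)⁻¹ • delta (k * m) := lift_delta ..

theorem norm_reindex_le (k : ℕ) (a : EllOne) : ‖reindex k a‖ ≤ ‖a‖ := by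
  have := norm_lift_apply_le _ 1 (fun m => norm_inv_smul_delta_le m (k * m)) a
  rwa [one_mul] at this

theorem ev_reindex (k : ℕ) (x : Torus) (a : EllOne) :
    ev 1 isWeight_one x (reindex k a) = ev k isWeight_succ x a := by
  have : (ev 1 isWeight_one x).comp (reindex k) = ev k isWeight_succ x := by
    refine clm_ext fun m => ?_
    rw [ContinuousLinearMap.comp_apply, reindex_delta, map_smul, ev_delta, ev_delta, one_mul,
      inv_one, one_mul, smul_eq_mul]
  exact DFunLike.congr_fun this a

theorem fracOp_reindex {α : ℝ} (hα : 0 < α) (k : ℕ) (a : EllOne) :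
    fracOp hα 1 (reindex k a) = reindex k (fracOp hα k a) := by
  have : (fracOp hα 1).comp (reindex k) = (reindex k).comp (fracOp hα k) := by
    refine clm_ext fun m => ?_
    simp only [ContinuousLinearMap.comp_apply, reindex_delta, map_smul, fracOp, diag_delta]
    rw [smul_comm, symb, symb, one_mul]
  exact DFunLike.congr_fun this a

theorem modeCoeff_reindex {k : ℕ} (hk : k ≠ 0) (a : EllOne) :
    modeCoeff (fun _ => 1) k (reindex k a) = modeCoeff (fun m => (m : ℝ) + 1) 1 a := by
  have : (modeCoeff (fun _ => 1) k).comp (reindex k) = modeCoeff (fun m => (m : ℝ) + 1) 1 := by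
    refine clm_ext fun m => ?_
    rw [ContinuousLinearMap.comp_apply, reindex_delta, map_smul, modeCoeff_apply, modeCoeff_apply,
      delta_apply, delta_apply]
    by_cases h : m = 1
    · subst h; simp
    · have : k ≠ k * m := fun h' => h (by
        have := Nat.eq_of_mul_eq_mul_left (Nat.pos_of_ne_zero hk) ((mul_one k).trans h')
        exact this.symm)
      rw [if_neg this, if_neg (Ne.symm h)]
      simp
  exact DFunLike.congr_fun this a

theorem reindex_zero_coeff {k : ℕ} (hk : k ≠ 0) (a : EllOne) : reindex k a 0 = a 0 := by
  have : (coord 0).comp (reindex k) = coord 0 := by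
    refine clm_ext fun m => ?_
    rw [ContinuousLinearMap.comp_apply, reindex_delta, map_smul, coord_apply, coord_apply,
      delta_apply, delta_apply]
    rcases eq_or_ne m 0 with rfl | hm
    · simp
    · rw [if_neg (mul_ne_zero hk hm).symm, if_neg hm.symm, smul_zero]
  exact DFunLike.congr_fun this a

/-- Both sides represent the same pointwise nonlinearity up to a constant, and both have zeroth
coefficient 0. -/
theorem nonlin_reindex {k : ℕ} (hk : k ≠ 0) {d : ℕ → ℝ} (j : ℕ) {q : ℝ → ℝ} {r : ℝ}
    (hq : HasScalarSeries q d r) {a : EllOne} (ha : ‖a‖ ^ 2 ≤ r) :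
    nonlin isWeight_one d j (reindex k a) = reindex k (nonlin isWeight_succ d j a) := by
  have ha' : ‖reindex k a‖ ^ 2 ≤ r :=
    (pow_le_pow_left₀ (norm_nonneg _) (norm_reindex_le k a) 2).trans ha
  obtain ⟨b, hb, hb'⟩ := ev_nonlin isWeight_succ j hq (κ := k) ha
  obtain ⟨b', hc, hc'⟩ := ev_nonlin isWeight_one j hq (κ := 1) ha'
  have h1 : ∀ x, ev 1 isWeight_one x (reindex k b) = ev 1 isWeight_one x b' := fun x => by
    rw [ev_reindex, hb, hc, ev_reindex]
  have h2 := ev_injective isWeight_one one_ne_zero h1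
  refine ext_of_ev_eq_add_const isWeight_one (C := b 0 - b' 0) one_ne_zero (fun x => ?_) ?_
  · rw [ev_reindex, hb', hc', hb, hc, ev_reindex]; ring
  · rw [nonlin_zero_coeff, reindex_zero_coeff hk, nonlin_zero_coeff]

theorem Solves.reindex {α : ℝ} {hα : 0 < α} {k : ℕ} (hk : k ≠ 0) {d : ℕ → ℝ} {j : ℕ} {q : ℝ → ℝ} {r : ℝ}
    (hq : HasScalarSeries q d r) {a : EllOne} {c : ℝ} (ha : ‖a‖ ^ 2 ≤ r)
    (h : Solves hα k isWeight_succ d j a c) :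
    Solves hα 1 isWeight_one d j (NegDispersive.reindex k a) c := by
  rw [Solves, fracOp_reindex, nonlin_reindex hk j hq ha, ← map_smul, ← map_sub, ← map_add]
  exact (congrArg _ h).trans (map_zero _)

end Reindex

theorem removeMean_of_zero {a : EllOne} (h : a 0 = 0) : removeMean a = a := by
  rw [removeMean_eq, h, zero_smul, sub_zero]

section Steady

variable {α : ℝ} (hα : 0 < α) {β : ℝ≥0} (hβ : 1 / 2 < (β : ℝ)) {n : ℝ → ℝ} {d : ℕ → ℝ} {j : ℕ}
  {q : ℝ → ℝ} {r : ℝ} (hq : HasScalarSeries q d r) (hn : ∀ x, n x = x ^ j * q (x ^ 2))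

include hq hn in
theorem steadyOp_eq_ev (f : EvenHolder β) (hf : ‖coeffSeq hβ f‖ ^ 2 ≤ r) (c : ℝ) (x : Torus) :
    steadyOp α n f c x = ev 1 isWeight_one x (fracOp hα 1 (coeffSeq hβ f) - c • coeffSeq hβ f +
      nonlin isWeight_one d j (coeffSeq hβ f)) := by
  obtain ⟨b, hb, hb'⟩ := ev_nonlin isWeight_one j hq (κ := 1) hf
  have h1 : ∀ y, n (f y) = ev 1 isWeight_one y b := fun y => by
    rw [hb, ev_coeffSeq, hn]
  have h2 : ⨍ y, n (f y) = b 0 := by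
    simp only [h1]
    exact average_ev isWeight_one one_ne_zero b
  rw [steadyOp, h2, h1, map_add, map_sub, map_smul, hb', ev_coeffSeq, fracInt_eq_ev hβ f hα,
    smul_eq_mul]
  ring

include hq hn in
theorem isSteady_iff (f : EvenHolder β) (hf : ‖coeffSeq hβ f‖ ^ 2 ≤ r) (c : ℝ) :
    IsSteady α n f c ↔ 0 ≤ c ∧ Solves hα 1 isWeight_one d j (coeffSeq hβ f) c := by
  refine and_congr_right fun _ => ⟨fun h => ?_, fun h x => ?_⟩
  · refine ev_injective isWeight_one one_ne_zero fun x => ?_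
    rw [← steadyOp_eq_ev hα hβ hq hn f hf, h, map_zero]
  · rw [steadyOp_eq_ev hα hβ hq hn f hf, h, map_zero]

theorem coeffSeq_embed {k : ℕ} (hk : k ≠ 0) (hβ1 : β ≤ 1) {a : EllOne} (ha : a 0 = 0) :
    coeffSeq hβ (embed hk hβ1 a) = reindex k a := by
  refine ev_injective isWeight_one one_ne_zero fun x => ?_
  rw [ev_coeffSeq, ev_reindex, embed_apply, removeMean_of_zero ha]

/-- The zeroth coefficient of the equation reads -c · a 0 = 0. Zero mean is thus automatic for
solutions with nonzero speed and is not built into the sequence space. -/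
theorem Solves.zero_coeff {κ : ℕ} {w : ℕ → ℝ} {hw : IsWeight w} {a : EllOne} {c : ℝ}
    (h : Solves hα κ hw d j a c) (hc : c ≠ 0) : a 0 = 0 := by
  have h1 : (fracOp hα κ a - c • a + nonlin hw d j a) 0 = 0 := by rw [h]; rfl
  rw [lp.coeFn_add, Pi.add_apply, lp.coeFn_sub, Pi.sub_apply, lp.coeFn_smul, Pi.smul_apply,
    nonlin_zero_coeff, fracOp_apply, symb_zero hα] at h1
  simpa [hc] using h1

theorem symb_one_eq (k : ℕ) : symb α 1 k = symb α k 1 := by rw [symb, symb, one_mul, mul_one]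

theorem ev_add_period {k : ℕ} (hk : k ≠ 0) (x : Torus) (a : EllOne) :
    ev k isWeight_succ (x + ((2 * π / k : ℝ) : Torus)) a = ev k isWeight_succ x a := by
  have h1 : x + ((2 * π / k : ℝ) : Torus) = x + ((π / k : ℝ) : Torus) + ((π / k : ℝ) : Torus) := by
    rw [add_assoc, ← AddCircle.coe_add]; congr 2; ring
  have h2 : halfShift (halfShift a) = a := by
    ext m
    rw [halfShift_apply, halfShift_apply, ← mul_assoc, ← mul_pow]; simp
  rw [h1, ← ev_halfShift isWeight_succ hk, ← ev_halfShift isWeight_succ hk, h2]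

include hα hβ hq hn in
/-- The local curve of nontrivial solutions for the nonlinearity `xʲ q(x²)`, together with the
sequences that represent its profiles. -/
theorem exists_isLocalCurve (hj : 2 ≤ j) (hβ1 : β ≤ 1) (k : ℕ+) :
    ∃ (δ : ℝ) (φ : ℝ → EllOne) (c : ℝ → ℝ), IsModeCurve hα k 1 isWeight_succ d j φ c ∧
      IsLocalCurve α n k δ (fun s => embed k.ne_zero hβ1 (φ s)) c ∧
      (∀ s ∈ Set.Ioo (-δ) δ, cosineCoeff (embed k.ne_zero hβ1 (φ s)) k = s) ∧
      ∀ s ∈ Set.Ioo (-δ) δ, c (-s) = c s := by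
  have hk : (k : ℕ) ≠ 0 := k.ne_zero
  -- The first curve lives among Lipschitz functions of period 2π/k and is the one exhibited. The
  -- second lives in the Wiener algebra, where every nearby Hölder solution can be recognised.
  obtain ⟨φ, c, h₁⟩ := exists_isModeCurve hα hk one_ne_zero isWeight_succ hj hq
  obtain ⟨φ₂, c₂, h₂⟩ := exists_isModeCurve hα one_ne_zero hk isWeight_one hj hq
  have hμ : symb α 1 k = symb α k 1 := symb_one_eq k
  have hμ0 : 0 < symb α k 1 := symb_pos α hk one_ne_zero
  have hφ0 : Tendsto φ (𝓝 0) (𝓝 0) := by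
    simpa [ContinuousAt, h₁.profile_zero] using h₁.analytic_profile.continuousAt
  have hc0 : Tendsto c (𝓝 0) (𝓝 (symb α k 1)) := by
    simpa [ContinuousAt, h₁.speed_zero] using h₁.analytic_speed.continuousAt
  have hsmall : ∀ᶠ a : EllOne in 𝓝 0, ‖a‖ ^ 2 < r := by
    have : Tendsto (fun a : EllOne => ‖a‖ ^ 2) (𝓝 0) (𝓝 0) :=
      Continuous.tendsto' (by fun_prop) _ _ (by simp)
    exact this.eventually_lt_const hq.pos
  have hIφ : Tendsto (fun s => (reindex k (φ s), c s)) (𝓝 0) (𝓝 (0, symb α 1 k)) := by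
    rw [hμ, nhds_prod_eq]
    exact (((reindex k).continuous.tendsto' 0 0 (map_zero _)).comp hφ0).prodMk hc0
  -- The first curve consists of solutions in the Wiener algebra with the same k-th coefficient s,
  -- so exhaustion there identifies it with the second.
  have hmatch : ∀ᶠ s in 𝓝 0, reindex k (φ s) = φ₂ s ∧ c s = c₂ s := by
    filter_upwards [hIφ.eventually h₂.exhausts, h₁.solves, hφ0.eventually hsmall] with s e1 e2 e3
    rcases eq_or_ne s 0 with rfl | hs
    · rw [h₁.profile_zero, h₂.profile_zero, map_zero, h₁.speed_zero, h₂.speed_zero, hμ]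
      exact ⟨rfl, rfl⟩
    · have e4 : modeCoeff (fun _ => 1) k (reindex k (φ s)) = s := by
        rw [modeCoeff_reindex hk, h₁.coeff]
      have e5 := e1 (e2.reindex hk hq e3.le) fun h0 => hs (by
        change reindex k (φ s) = 0 at h0
        rw [← e4, h0, map_zero])
      simp only [e4] at e5
      exact e5
  obtain ⟨δ, hδ, hball⟩ := Metric.eventually_nhds_iff.1
    (((h₁.analytic_profile.eventually_analyticAt.and h₁.analytic_speed.eventually_analyticAt).and
      (h₁.solves.and (hφ0.eventually hsmall))).and ((hmatch.and (h₁.speed_even hk hq)).and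
        (hc0.eventually_const_lt hμ0)))
  have hI : ∀ s ∈ Set.Ioo (-δ) δ, _ := fun s hs => @hball s (by
    rw [Real.dist_eq, sub_zero]; exact abs_lt.2 hs)
  have hz : ∀ s ∈ Set.Ioo (-δ) δ, φ s 0 = 0 := fun s hs =>
    (hI s hs).1.2.1.zero_coeff hα (hI s hs).2.2.ne'
  have hev : ∀ s ∈ Set.Ioo (-δ) δ, ∀ x,
      embed hk hβ1 (φ s) x = ev k isWeight_succ x (φ s) := fun s hs x => by
    rw [embed_apply, removeMean_of_zero (hz s hs)]
  have hcoef : ∀ s ∈ Set.Ioo (-δ) δ, cosineCoeff (embed hk hβ1 (φ s)) k = s := fun s hs => by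
    rw [funext (hev s hs), cosineCoeff_ev isWeight_succ hk 1 k (mul_one _).symm, h₁.coeff]
  refine ⟨δ, φ, c, h₁, ?_, hcoef, fun s hs => (hI s hs).2.1.2⟩
  refine
    { pos := hδ
      analytic_profile := fun s hs =>
        ((embed hk hβ1).analyticAt _).fun_comp (hI s hs).1.1.1
      analytic_speed := fun s hs => (hI s hs).1.1.2
      profile_zero := by rw [h₁.profile_zero, map_zero]
      speed_zero := by rw [h₁.speed_zero, symb, mul_one]
      steady := fun s hs => ?_
      nontrivial := fun s hs hs0 h0 => hs0 ?_
      periodic := fun s hs x => ?_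
      exhausts := ?_ }
  · have e1 := coeffSeq_embed hβ hk hβ1 (hz s hs)
    have e2 := (hI s hs).1.2.2.le
    refine (isSteady_iff hα hβ hq hn _ ?_ _).2 ⟨(hI s hs).2.2.le, ?_⟩
    · rw [e1]
      exact (pow_le_pow_left₀ (norm_nonneg _) (norm_reindex_le k _) 2).trans e2
    · rw [e1]
      exact (hI s hs).1.2.1.reindex hk hq e2
  · rw [← hcoef s hs, h0]
    have : ∀ x, (0 : EvenHolder β) x = 0 := fun _ => rfl
    simp [cosineCoeff, this]
  · rw [hev s hs, hev s hs, ev_add_period hk]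
  · have t1 : Tendsto (fun z : EvenHolder β × ℝ => (coeffSeq hβ z.1, z.2))
        (𝓝 (0, (k : ℝ) ^ (-α))) (𝓝 (0, symb α 1 k)) := by
      have : symb α 1 k = (k : ℝ) ^ (-α) := by rw [symb, one_mul]
      rw [this, nhds_prod_eq, nhds_prod_eq]
      exact (tendsto_coeffSeq hβ).prodMap tendsto_id
    have t2 : Tendsto (fun z : EvenHolder β × ℝ => coeffSeq hβ z.1)
        (𝓝 (0, (k : ℝ) ^ (-α))) (𝓝 0) :=
      (continuous_fst.tendsto (0, symb α 1 k)).comp t1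
    have t3 : Tendsto (fun z : EvenHolder β × ℝ => modeCoeff (fun _ => 1) k (coeffSeq hβ z.1))
        (𝓝 (0, (k : ℝ) ^ (-α))) (𝓝 0) :=
      ((modeCoeff (fun _ => 1) k).continuous.tendsto' 0 0 (map_zero _)).comp t2
    -- A nearby Hölder solution has small coefficients in the Wiener algebra, hence lies on the
    -- second curve and so on the first. Its period and its Lipschitz regularity come out as
    -- consequences.
    filter_upwards [t1.eventually h₂.exhausts, t2.eventually hsmall,
      t3.eventually (Ioo_mem_nhds (neg_lt_zero.2 hδ) hδ)] with z e1 e2 e3 hst hz0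
    have e4 := ((isSteady_iff hα hβ hq hn _ e2.le _).1 hst).2
    have e5 : coeffSeq hβ z.1 ≠ 0 := fun h0 => hz0 (by
      refine EvenHolder.toCont_injective (ContinuousMap.ext fun x => ?_)
      rw [← ev_coeffSeq hβ, h0, map_zero]; rfl)
    obtain ⟨e6, e7⟩ := e1 e4 e5
    set s := modeCoeff (fun _ => 1) k (coeffSeq hβ z.1)
    have e8 := (hI s e3).2.1.1
    refine ⟨s, e3, Prod.ext (EvenHolder.toCont_injective (ContinuousMap.ext fun x => ?_)) ?_⟩
    · rw [← ev_coeffSeq hβ, hev s e3, e6, ← e8.1, ev_reindex]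
    · rw [e7, e8.2]

end Steady

end NegDispersive

/-! ### The two regularised nonlinearities and the conclusion. -/

namespace NegDispersive

open EllOne

section Nonlinearities

/-- The quotient of `(t + ε²)^ρ - ε^(2ρ)` by `t` is analytic at the origin. -/
theorem exists_analyticAt_rpow_sub_eq_mul {ε : ℝ} (hε : 0 < ε) (ρ : ℝ) :
    ∃ q : ℝ → ℝ, AnalyticAt ℝ q 0 ∧ q 0 = ρ * ε ^ (2 * ρ - 2) ∧
      ∀ t, (t + ε ^ 2) ^ ρ - ε ^ (2 * ρ) = t * q t := by
  set f : ℝ → ℝ := fun t => (t + ε ^ 2) ^ ρ with hf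
  have hε2 : (0 : ℝ) < ε ^ 2 := by positivity
  have h0 : AnalyticAt ℝ f 0 := by
    have h1 : AnalyticAt ℝ (fun t : ℝ => t + ε ^ 2) 0 := by fun_prop
    refine ((h1.log (by simpa using hε2)).mul (analyticAt_const (v := ρ))).rexp.congr ?_
    filter_upwards [lt_mem_nhds (neg_lt_zero.2 hε2)] with t ht
    exact (Real.rpow_def_of_pos (by linarith) ρ).symm
  have hpow : ∀ σ : ℝ, (ε ^ 2) ^ σ = ε ^ (2 * σ) := fun σ => by
    rw [← Real.rpow_natCast, ← Real.rpow_mul hε.le]; norm_num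
  -- The divided difference at 0 remains analytic when f is, and its value at 0 is f'(0) = ρ
  -- (ε²)^(ρ-1).
  refine ⟨dslope f 0, ?_, ?_, fun t => ?_⟩
  · obtain ⟨P, hP⟩ := h0
    exact hP.has_fpower_series_dslope_fslope.analyticAt
  · have h2 : HasDerivAt f (1 * ρ * (0 + ε ^ 2) ^ (ρ - 1)) 0 :=
      ((hasDerivAt_id (0 : ℝ)).add_const (ε ^ 2)).rpow_const (Or.inl (by simpa using hε2.ne'))
    rw [dslope_same, h2.deriv, one_mul, zero_add, hpow, mul_sub, mul_one]
  · have h3 := sub_smul_dslope f 0 t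
    rw [sub_zero, smul_eq_mul] at h3
    rw [h3]; simp only [hf]; rw [zero_add, hpow]

variable {ε : ℝ} (hε : 0 < ε) (p : ℝ)
include hε

theorem exists_nAbs_eq : ∃ q : ℝ → ℝ, AnalyticAt ℝ q 0 ∧ q 0 = p / 2 * ε ^ (p - 2) ∧
    ∀ x, nAbs p ε x = x ^ 2 * q (x ^ 2) := by
  obtain ⟨q, h1, h2, h3⟩ := exists_analyticAt_rpow_sub_eq_mul hε (p / 2)
  rw [mul_div_cancel₀ p two_ne_zero] at h2 h3
  exact ⟨q, h1, h2, fun x => by rw [nAbs, h3]⟩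

theorem exists_nSgn_eq : ∃ q : ℝ → ℝ, AnalyticAt ℝ q 0 ∧ q 0 = (p - 1) / 2 * ε ^ (p - 3) ∧
    ∀ x, nSgn p ε x = x ^ 3 * q (x ^ 2) := by
  obtain ⟨q, h1, h2, h3⟩ := exists_analyticAt_rpow_sub_eq_mul hε ((p - 1) / 2)
  rw [mul_div_cancel₀ (p - 1) two_ne_zero] at h2 h3
  refine ⟨q, h1, ?_, fun x => by rw [nSgn, h3]; ring⟩
  rw [h2]; congr 2; ring

end Nonlinearities

theorem symb_two (α : ℝ) (k : ℕ) : symb α k 2 = (2 * k : ℝ) ^ (-α) := by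
  rw [symb, mul_comm]; push_cast; rfl

theorem symb_three (α : ℝ) (k : ℕ) : symb α k 3 = (3 * k : ℝ) ^ (-α) := by
  rw [symb, mul_comm]; push_cast; rfl

theorem embed_sub_isBigO {β : ℝ≥0} {k : ℕ+} (hβ1 : β ≤ 1) {φ : ℝ → EllOne} {C : ℝ} {j i m : ℕ}
    (l : ℕ+) (hl : (l : ℕ) = k * m)
    (h : (fun s : ℝ => φ s - (s • mode (fun m => (m : ℝ) + 1) 1 +
      (s ^ j * C) • mode (fun m => (m : ℝ) + 1) m)) =O[𝓝 0] fun s : ℝ => s ^ i) :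
    (fun s : ℝ => embed k.ne_zero hβ1 (φ s) -
      (s • cosMode hβ1 k + (s ^ j * C) • cosMode hβ1 l)) =O[𝓝 0] fun s : ℝ => s ^ i := by
  refine (((embed k.ne_zero hβ1).isBigO_comp _ _).trans h).congr_left fun s => ?_
  rw [map_sub, map_add, map_smul, map_smul, embed_mode k.ne_zero hβ1 k (mul_one _).symm,
    embed_mode k.ne_zero hβ1 l hl]

end NegDispersive

open NegDispersive in
theorem mainTheorem9 (α : ℝ) (hα : α ∈ Set.Ioo (0 : ℝ) 1) (p : ℝ) (hp : 1 < p)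
    (β : ℝ≥0) (hβ : max α (1 / 2) < (β : ℝ)) (hβ1 : β < 1) (ε : ℝ) (hε : 0 < ε) (k : ℕ+) :
    (∃ (δ : ℝ) (φ : ℝ → NegDispersive.EvenHolder β) (c : ℝ → ℝ),
      NegDispersive.IsLocalCurve α (NegDispersive.nAbs p ε) k δ φ c ∧
      (∀ s ∈ Set.Ioo (-δ) δ, NegDispersive.cosineCoeff (φ s) k = s) ∧
      (∀ s ∈ Set.Ioo (-δ) δ, c (-s) = c s) ∧
      (fun s : ℝ => φ s - (s • NegDispersive.cosMode hβ1.le k +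
          (s ^ 2 * NegDispersive.coeffAbs α p ε k) • NegDispersive.cosMode hβ1.le (2 * k)))
        =O[𝓝 0] (fun s : ℝ => s ^ 3) ∧
      (fun s : ℝ => c s - ((k : ℝ) ^ (-α) +
          s ^ 2 * (1 / 2 * p * ε ^ (p - 2) * NegDispersive.coeffAbs α p ε k)))
        =O[𝓝 0] (fun s : ℝ => s ^ 4)) ∧
    (∃ (δ : ℝ) (φ : ℝ → NegDispersive.EvenHolder β) (c : ℝ → ℝ),
      NegDispersive.IsLocalCurve α (NegDispersive.nSgn p ε) k δ φ c ∧
      (∀ s ∈ Set.Ioo (-δ) δ, NegDispersive.cosineCoeff (φ s) k = s) ∧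
      (∀ s ∈ Set.Ioo (-δ) δ, c (-s) = c s) ∧
      (fun s : ℝ => φ s - (s • NegDispersive.cosMode hβ1.le k +
          (s ^ 3 * NegDispersive.coeffSgn α p ε k) • NegDispersive.cosMode hβ1.le (3 * k)))
        =O[𝓝 0] (fun s : ℝ => s ^ 5) ∧
      (fun s : ℝ => c s - ((k : ℝ) ^ (-α) +
          s ^ 2 * (3 / 8 * (p - 1) * ε ^ (p - 3))))
        =O[𝓝 0] (fun s : ℝ => s ^ 4)) := by
  have hβ2 : 1 / 2 < (β : ℝ) := (le_max_right _ _).trans_lt hβ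
  have h1 : symb α k 1 = (k : ℝ) ^ (-α) := by rw [symb, mul_one]
  constructor
  · obtain ⟨q, hq, hq0, hn⟩ := exists_nAbs_eq hε p
    obtain ⟨d, r, hd⟩ := exists_hasScalarSeries hq
    have hd0 := hd.coeff_zero
    obtain ⟨δ, φ, c, hm, hc, hcos, heven⟩ :=
      exists_isLocalCurve hα.1 hβ2 hd hn le_rfl hβ1.le k
    -- Since d 0 = q 0 = (p/2) ε^(p-2), half of it is the numerator (p/4) ε^(p-2).
    have hC : d 0 / 2 / (symb α k 1 - symb α k 2) = coeffAbs α p ε k := by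
      rw [hd0, hq0, h1, symb_two, coeffAbs]; ring_nf
    have hφ := hm.profile_sub_isBigO_two k.ne_zero hd
    have hs := hm.speed_sub_isBigO_two k.ne_zero hd
    rw [hC] at hφ hs
    refine ⟨δ, _, c, hc, hcos, heven, embed_sub_isBigO hβ1.le (2 * k) (mul_comm _ _) hφ,
      hs.congr_left fun s => ?_⟩
    rw [h1, hd0, hq0]; ring
  · obtain ⟨q, hq, hq0, hn⟩ := exists_nSgn_eq hε p
    obtain ⟨d, r, hd⟩ := exists_hasScalarSeries hq
    have hd0 := hd.coeff_zero
    obtain ⟨δ, φ, c, hm, hc, hcos, heven⟩ :=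
      exists_isLocalCurve hα.1 hβ2 hd hn (by norm_num) hβ1.le k
    -- Since d 0 = q 0 = ((p-1)/2) ε^(p-3), a quarter of it is the numerator, and three quarters of
    -- it give the speed coefficient (3/8)(p-1) ε^(p-3).
    have hC : d 0 / 4 / (symb α k 1 - symb α k 3) = coeffSgn α p ε k := by
      rw [hd0, hq0, h1, symb_three, coeffSgn]; ring_nf
    have hφ := hm.profile_sub_isBigO_three k.ne_zero hd
    have hs := hm.speed_sub_isBigO_three k.ne_zero hd
    rw [hC] at hφ
    refine ⟨δ, _, c, hc, hcos, heven, embed_sub_isBigO hβ1.le (3 * k) (mul_comm _ _) hφ,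
      hs.congr_left fun s => ?_⟩
    rw [h1, hd0, hq0]; ring
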